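/- Let $p>5$ be a prime with $p\equiv 1\pmod 4$ and let $G=PSL(2,p)$. Then the following choices are possible: there is $a\in G$ of order $p$; for every such $a$ there is $b\in G$ of order $\frac{p-1}{2}$ with $N_G(\langle a\rangle)=\langle a\rangle:\langle b\rangle$; and for all such $a,b$ there is an involution $g\in G$ such that $N_G(\langle b^2\rangle)=\langle b\rangle:\langle g\rangle$ is dihedral of order $p-1$. (Here $L=N:K$ means that $L$ is the internal semidirect product of its normal subgroup $N$ and its subgroup $K$.) For all $a,b,g$ chosen in this way, put $H=\langle a, b^2\rangle$. Then $H=\langle a\rangle:\langle b^2\rangle\cong \mathbb Z_p:\mathbb Z_{(p-1)/4}$ is a core-free proper subgroup of $G$ with $G=\langle H,g\rangle$ and $g^2\in H$, so that the coset graph $\Gamma=\mathrm{Cos}(G,H,HgH)$ is defined: its vertices are the right cosets $Hx$ ($x\in G$), and $Hx$, $Hy$ are adjacent if and only if $yx^{-1}\in HgH$. The graph $\Gamma$ is connected of valency $p$, and it is $2$-geodesic transitive but not $2$-arc transitive. Here a $t$-arc is a walk $(v_0,\dots,v_t)$ with $v_{j-1}\ne v_{j+1}$ for $1\le j\le t-1$,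 and a $t$-geodesic is a path $(v_0,\dots,v_t)$ whose ends are at distance $t$. A graph is $s$-arc transitive if, for every $1\le t\le s$, its full automorphism group is transitive on the set of $t$-arcs. A connected graph is $s$-geodesic transitive if $s$ is at most its diameter and, for every $1\le t\le s$, its full automorphism group is transitive on the set of $t$-geodesics. -/

import Mathlib

section Groups

variable {G : Type*} [Group G]

/-- `L = N : K`, i.e. `L` is the internal semidirect product of its normal subgroup `N` and its
subgroup `K`. -/
structure IsInternalSemidirect (L N K : Subgroup G) : Prop where
  sup_eq : N ⊔ K = L
  inf_eq : N ⊓ K = ⊥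
  normalizes : L ≤ Subgroup.normalizer (N : Set G)

/-- The standing assumptions under which the coset graph `Cos(G, H, HgH)` is formed: `H` is a
core-free proper subgroup of `G`, `G = ⟨H, g⟩`, and `g ^ 2 ∈ H`. -/
structure IsCosetDatum (H : Subgroup G) (g : G) : Prop where
  core_free : H.normalCore = ⊥
  proper : H ≠ ⊤
  generates : H ⊔ Subgroup.zpowers g = ⊤
  sq_mem : g ^ 2 ∈ H

theorem IsCosetDatum.not_mem {H : Subgroup G} {g : G} (h : IsCosetDatum H g) : g ∉ H := by
  intro hg
  apply h.proper
  rw [← h.generates, eq_comm, sup_eq_left, Subgroup.zpowers_le]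
  exact hg

/-- The coset graph `Cos(G, H, HgH)`: its vertices are the right cosets `Hx`, and `Hx`, `Hy` are
adjacent if and only if `y * x⁻¹ ∈ HgH`. -/
def cosetGraph (H : Subgroup G) (g : G) (h : IsCosetDatum H g) :
    SimpleGraph (Quotient (QuotientGroup.rightRel H)) where
  Adj U V := ∃ x y : G, Quotient.mk (QuotientGroup.rightRel H) x = U ∧
    Quotient.mk (QuotientGroup.rightRel H) y = V ∧
    y * x⁻¹ ∈ DoubleCoset.doubleCoset g (H : Set G) (H : Set G)
  symm := ⟨by
    rintro U V ⟨x, y, hx, hy, hxy⟩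
    refine ⟨y, x, hy, hx, ?_⟩
    rw [DoubleCoset.mem_doubleCoset] at hxy ⊢
    obtain ⟨k, hk, l, hl, e⟩ := hxy
    refine ⟨l⁻¹, H.inv_mem hl, (g ^ 2)⁻¹ * k⁻¹,
      H.mul_mem (H.inv_mem h.sq_mem) (H.inv_mem hk), ?_⟩
    have e' : x * y⁻¹ = (y * x⁻¹)⁻¹ := by group
    rw [e', e]
    group⟩
  loopless := ⟨by
    rintro U ⟨x, y, hx, hy, hxy⟩
    rw [DoubleCoset.mem_doubleCoset] at hxy
    obtain ⟨k, hk, l, hl, e⟩ := hxy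
    have hm : y * x⁻¹ ∈ H := by
      have := Quotient.exact (hx.trans hy.symm)
      exact QuotientGroup.rightRel_apply.mp this
    apply h.not_mem
    have : g = k⁻¹ * (y * x⁻¹) * l⁻¹ := by rw [e]; group
    rw [this]
    exact H.mul_mem (H.mul_mem (H.inv_mem hk) hm) (H.inv_mem hl)⟩

theorem cosetGraph_adj_mk (H : Subgroup G) (g : G) (h : IsCosetDatum H g) (x y : G) :
    (cosetGraph H g h).Adj (Quotient.mk (QuotientGroup.rightRel H) x)
        (Quotient.mk (QuotientGroup.rightRel H) y) ↔
      y * x⁻¹ ∈ DoubleCoset.doubleCoset g (H : Set G) (H : Set G) := by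
  refine ⟨?_, fun hxy => ⟨x, y, rfl, rfl, hxy⟩⟩
  rintro ⟨x', y', hx, hy, hxy⟩
  have h1 : x * x'⁻¹ ∈ H := QuotientGroup.rightRel_apply.mp (Quotient.exact hx)
  have h2 : y * y'⁻¹ ∈ H := QuotientGroup.rightRel_apply.mp (Quotient.exact hy)
  rw [DoubleCoset.mem_doubleCoset] at hxy ⊢
  obtain ⟨k, hk, l, hl, e⟩ := hxy
  refine ⟨(y * y'⁻¹) * k, H.mul_mem h2 hk, l * (x * x'⁻¹)⁻¹, H.mul_mem hl (H.inv_mem h1), ?_⟩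
  have : y * x⁻¹ = (y * y'⁻¹) * (y' * x'⁻¹) * (x * x'⁻¹)⁻¹ := by group
  rw [this, e]
  group

end Groups

section Graphs

variable {V : Type*}

/-- The sequence `(v 0, …, v s)` is a walk of length `s` of `Γ`. -/
def IsWalkSeq (Γ : SimpleGraph V) {s : ℕ} (v : Fin (s + 1) → V) : Prop :=
  ∀ i : Fin s, Γ.Adj (v i.castSucc) (v i.succ)

/-- An `s`-arc: a walk `(v 0, …, v s)` with `v (j - 1) ≠ v (j + 1)` for `1 ≤ j ≤ s - 1`. -/
def IsArcSeq (Γ : SimpleGraph V) {s : ℕ} (v : Fin (s + 1) → V) : Prop :=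
  IsWalkSeq Γ v ∧ ∀ i j : Fin (s + 1), (j : ℕ) = i + 2 → v i ≠ v j

/-- An `s`-geodesic: a path `(v 0, …, v s)` whose ends are at distance `s`. -/
def IsGeodesicSeq (Γ : SimpleGraph V) {s : ℕ} (v : Fin (s + 1) → V) : Prop :=
  IsWalkSeq Γ v ∧ Function.Injective v ∧ Γ.dist (v 0) (v (Fin.last s)) = s

/-- `Γ` is `s`-arc transitive: for `1 ≤ t ≤ s`, any two `t`-arcs are equivalent under the full
automorphism group of `Γ`. -/
def IsArcTransitive (Γ : SimpleGraph V) (s : ℕ) : Prop :=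
  ∀ t : ℕ, 1 ≤ t → t ≤ s → ∀ v w : Fin (t + 1) → V, IsArcSeq Γ v → IsArcSeq Γ w →
    ∃ σ : Γ ≃g Γ, ∀ i, σ (v i) = w i

/-- `Γ` is `s`-geodesic transitive: it is connected, `s` is at most the diameter, and for
`1 ≤ t ≤ s`, any two `t`-geodesics are equivalent under the full automorphism group of `Γ`. -/
def IsGeodesicTransitive (Γ : SimpleGraph V) (s : ℕ) : Prop :=
  Γ.Connected ∧ s ≤ Γ.diam ∧
  ∀ t : ℕ, 1 ≤ t → t ≤ s → ∀ v w : Fin (t + 1) → V, IsGeodesicSeq Γ v → IsGeodesicSeq Γ w →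
    ∃ σ : Γ ≃g Γ, ∀ i, σ (v i) = w i

end Graphs

section Construction

/-- The group `PSL(2, p)`. -/
abbrev PSL2 (p : ℕ) : Type := Matrix.ProjectiveSpecialLinearGroup (Fin 2) (ZMod p)

/-- The choice of `b`, given `a`: `b` has order `(p - 1) / 2` and `N_G(⟨a⟩) = ⟨a⟩ : ⟨b⟩`. -/
structure IsTorusChoice (p : ℕ) (a b : PSL2 p) : Prop where
  order_b : orderOf b = (p - 1) / 2
  normalizer_a : IsInternalSemidirect
    (Subgroup.normalizer (Subgroup.zpowers a : Set (PSL2 p)))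
    (Subgroup.zpowers a) (Subgroup.zpowers b)

/-- The choice of `g`, given `b`: `g` is an involution and `N_G(⟨b ^ 2⟩) = ⟨b⟩ : ⟨g⟩`, which is
dihedral of order `p - 1` (in Mathlib, `DihedralGroup n` has order `2 * n`). -/
structure IsInvolutionChoice (p : ℕ) (b g : PSL2 p) : Prop where
  order_g : orderOf g = 2
  normalizer_b : IsInternalSemidirect
    (Subgroup.normalizer (Subgroup.zpowers (b ^ 2) : Set (PSL2 p)))
    (Subgroup.zpowers b) (Subgroup.zpowers g)
  dihedral : Nonempty
    (Subgroup.normalizer (Subgroup.zpowers (b ^ 2) : Set (PSL2 p)) ≃* DihedralGroup ((p - 1) / 2))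

/-- The subgroup `H = ⟨a⟩⟨b ^ 2⟩` generated by `a` and `b ^ 2`. -/
def subgroupH {p : ℕ} (a b : PSL2 p) : Subgroup (PSL2 p) :=
  Subgroup.zpowers a ⊔ Subgroup.zpowers (b ^ 2)

end Construction

/-! ### Rank-one split BN-pairs and the index-two subgroup of the Borel subgroup. -/

section Abstract

variable {G : Type*} [Group G]

/-! Up to conjugation, `a` is upper unipotent, `b` generates the diagonal torus modulo signs, and
`g` is antidiagonal. Thus `P = ⟨a⟩⟨b⟩` is a Borel subgroup, `H` has index two in it because `b` has
even order (this is `p ≡ 1 mod 4`), and `g` inverts `b`.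

The neighbours of `H` are the cosets `Hgz` with `z ∈ ⟨a⟩`, all distinct, and every 2-arc is a
translate of `(Hg, H, Hgz)` with `z ≠ 1`. Its ends are adjacent exactly when `gzg ∈ HgH`.
Conjugation by `b` is a graph automorphism fixing `H` and `Hg`, although `b ∉ H`; it acts on the
nontrivial `z` through multiplication by squares, hence with two orbits.

Both kinds of `z` occur. If all `gzg` lay in `HgH`, then `H ∪ HgH` would be a subgroup, hence all of
`G`, yet it misses `b` (`exists_gzg_notMem`). The same argument for `bg` in place of `g`, together
with the Bruhat decomposition, gives some `gzg` in `HgH` (`exists_gzg_mem`). So adjacency of the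
ends separates the two orbits: 2-arcs fall into triangles and 2-geodesics, and the geodesics form a
single orbit.

The group-theoretic facts used are isolated in `IsRankOneTriple`; `isRankOneTriple_of_choice`
verifies them by matrix computation for every admissible `a`, `b`, `g`. -/

theorem mem_sup_zpowers_of_mem_normalizer {N : Subgroup G} {b : G}
    (hb : b ∈ Subgroup.normalizer (N : Set G)) {x : G} :
    x ∈ N ⊔ Subgroup.zpowers b ↔ ∃ z ∈ N, ∃ k : ℤ, x = z * b ^ k := by
  rw [← SetLike.mem_coe, Subgroup.coe_mul_of_right_le_normalizer_left _ _
    (Subgroup.zpowers_le.mpr hb), Set.mem_mul]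
  constructor
  · rintro ⟨z, hz, _, ⟨k, rfl⟩, rfl⟩
    exact ⟨z, hz, k, rfl⟩
  · rintro ⟨z, hz, k, rfl⟩
    exact ⟨z, hz, _, ⟨k, rfl⟩, rfl⟩

theorem zpowers_eq_of_mem_of_ne_one {a z : G} (ha : (orderOf a).Prime)
    (hz : z ∈ Subgroup.zpowers a) (hz1 : z ≠ 1) : Subgroup.zpowers z = Subgroup.zpowers a := by
  have := ha.ne_zero
  have hfin : Finite (Subgroup.zpowers a) :=
    Nat.finite_of_card_ne_zero (by rwa [Nat.card_zpowers])
  have hle : Subgroup.zpowers z ≤ Subgroup.zpowers a := Subgroup.zpowers_le.mpr hz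
  refine Subgroup.eq_of_le_of_card_ge hle ?_
  rw [Nat.card_zpowers, Nat.card_zpowers]
  have hd : orderOf z ∣ orderOf a := by
    simpa [Nat.card_zpowers] using Subgroup.card_dvd_of_le hle
  rcases (Nat.dvd_prime ha).mp hd with h | h
  · exact absurd (orderOf_eq_one_iff.mp h) hz1
  · exact h.ge

/-- An element `a` of prime order, an element `b` normalizing `⟨a⟩` and an involution `g`
inverting `b`, such that `⟨a⟩⟨b⟩` and `g` form a split `BN`-pair of rank one in which `b` has at
most two orbits on the nontrivial elements of `⟨a⟩`. -/
structure IsRankOneTriple (a b g : G) : Prop where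
  prime_orderOf : (orderOf a).Prime
  mul_self : g * g = 1
  inverts : g * b * g = b⁻¹
  normalizes : b ∈ Subgroup.normalizer (Subgroup.zpowers a : Set G)
  disjoint : Subgroup.zpowers a ⊓ Subgroup.zpowers b = ⊥
  even : Even (orderOf b)
  bruhat : ∀ x, x ∈ Subgroup.zpowers a ⊔ Subgroup.zpowers b ∨
    ∃ y ∈ Subgroup.zpowers a ⊔ Subgroup.zpowers b, ∃ z ∈ Subgroup.zpowers a, x = y * g * z
  generate : ∀ K : Subgroup G, Subgroup.zpowers a ≤ K →
    (∀ z ∈ Subgroup.zpowers a, g * z * g ∈ K) → K = ⊤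
  orbits : ∀ x ∈ Subgroup.zpowers a, ∀ y ∈ Subgroup.zpowers a, ∀ z ∈ Subgroup.zpowers a,
    x ≠ 1 → y ≠ 1 → z ≠ 1 → (∃ k : ℤ, y = b ^ k * x * b ^ (-k)) ∨
      (∃ k : ℤ, z = b ^ k * x * b ^ (-k)) ∨ ∃ k : ℤ, z = b ^ k * y * b ^ (-k)
  faithful : ∀ x ∈ Subgroup.zpowers b, Commute x a → x = 1

namespace IsRankOneTriple

variable {a b g : G}

local notation "A" => Subgroup.zpowers a
local notation "B" => Subgroup.zpowers b
local notation "H" => Subgroup.zpowers a ⊔ Subgroup.zpowers (b ^ 2)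
local notation "D" => DoubleCoset.doubleCoset g
  ((Subgroup.zpowers a ⊔ Subgroup.zpowers (b ^ 2) : Subgroup G) : Set G)
  ((Subgroup.zpowers a ⊔ Subgroup.zpowers (b ^ 2) : Subgroup G) : Set G)
local notation "P" => Subgroup.zpowers a ⊔ Subgroup.zpowers b

theorem inv_g (h : IsRankOneTriple a b g) : g⁻¹ = g :=
  inv_eq_of_mul_eq_one_left h.mul_self

theorem g_mul_zpow (h : IsRankOneTriple a b g) (k : ℤ) : g * b ^ k = b ^ (-k) * g := by
  have e : g * b * g⁻¹ = b⁻¹ := by rw [h.inv_g, h.inverts]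
  have := conj_zpow (i := k) (a := g) (b := b)
  rw [e] at this
  rw [zpow_neg, ← inv_zpow, this]
  group

theorem zpow_conj_mem (h : IsRankOneTriple a b g) {z : G} (hz : z ∈ A) (k : ℤ) :
    b ^ k * z * b ^ (-k) ∈ A := by
  have := (Subgroup.mem_normalizer_iff.mp
    (Subgroup.zpow_mem _ h.normalizes k) z).mp hz
  rwa [zpow_neg]

/-- The torus factor stands on the left so that `g_mul_zpow` can carry it across a preceding `g`. -/
theorem mem_H (h : IsRankOneTriple a b g) {x : G} :
    x ∈ H ↔ ∃ k : ℤ, ∃ z ∈ A, x = b ^ (2 * k) * z := by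
  rw [mem_sup_zpowers_of_mem_normalizer (Subgroup.pow_mem _ h.normalizes 2)]
  have e : ∀ k : ℤ, (b ^ 2) ^ k = b ^ (2 * k) := fun k => by
    rw [zpow_mul]; norm_cast
  constructor
  · rintro ⟨z, hz, k, rfl⟩
    rw [e]
    exact ⟨k, _, h.zpow_conj_mem hz (-(2 * k)), by group⟩
  · rintro ⟨k, z, hz, rfl⟩
    exact ⟨_, h.zpow_conj_mem hz (2 * k), k, by rw [e]; group⟩

theorem A_le_H : A ≤ H := le_sup_left

theorem H_le_P : H ≤ P :=
  sup_le_sup_left (Subgroup.zpowers_le.mpr (Subgroup.pow_mem _ (Subgroup.mem_zpowers b) 2)) _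

theorem sq_zpow_mem_H (k : ℤ) : b ^ (2 * k) ∈ H := by
  refine Subgroup.mem_sup_right ⟨k, ?_⟩
  rw [zpow_mul]; norm_cast

/-- Since `⟨a⟩ ∩ ⟨b⟩` is trivial, membership would give `b ^ (2k - 1) = 1`, impossible for an
element of even order. -/
theorem b_notMem_H (h : IsRankOneTriple a b g) : b ∉ H := by
  intro hb
  obtain ⟨k, z, hz, e⟩ := h.mem_H.mp hb
  have hzb : z ∈ A ⊓ B := ⟨hz, 1 - 2 * k, by
    have : z = b ^ (-(2 * k)) * b := by
      nth_rewrite 2 [e]; group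
    rw [this, ← zpow_add_one]
    congr 1; ring⟩
  rw [h.disjoint, Subgroup.mem_bot] at hzb
  rw [hzb, mul_one] at e
  have e' : b ^ (2 * k - 1) = 1 := by rw [zpow_sub_one, ← e]; group
  have hd := orderOf_dvd_iff_zpow_eq_one.mpr e'
  have h2 : (2 : ℤ) ∣ 2 * k - 1 :=
    dvd_trans (by exact_mod_cast h.even.two_dvd) hd
  omega

/-- Everything in `P` normalizes `⟨a⟩`; were `g` to do so, `generate` would give `⟨a⟩ = G`, which
lacks `b`. -/
theorem g_notMem_P (h : IsRankOneTriple a b g) : g ∉ P := by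
  intro hg
  have hle : P ≤ Subgroup.normalizer (A : Set G) :=
    sup_le Subgroup.le_normalizer (Subgroup.zpowers_le.mpr h.normalizes)
  have hA : A = ⊤ := h.generate _ le_rfl fun z hz => by
    have := (Subgroup.mem_normalizer_iff.mp (hle hg) z).mp hz
    rwa [h.inv_g] at this
  exact h.b_notMem_H (A_le_H (hA ▸ Subgroup.mem_top b))

/-- As `⟨a⟩` has prime order, `z` generates it, so `gzg ∈ P` would put all of `g⟨a⟩g` in `P` and
force `P = G`. -/
theorem gzg_notMem_P (h : IsRankOneTriple a b g) {z : G} (hz : z ∈ A) (hz1 : z ≠ 1) :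
    g * z * g ∉ P := by
  intro hm
  have hP : P = ⊤ := h.generate _ le_sup_left fun y hy => by
    rw [← zpowers_eq_of_mem_of_ne_one h.prime_orderOf hz hz1] at hy
    obtain ⟨k, rfl⟩ := hy
    have := Subgroup.zpow_mem _ hm k
    nth_rewrite 2 [← h.inv_g] at this
    rw [conj_zpow, h.inv_g] at this
    exact this
  exact h.g_notMem_P (hP ▸ Subgroup.mem_top g)

theorem mem_P_cases (h : IsRankOneTriple a b g) {x : G} (hx : x ∈ P) :
    x ∈ H ∨ ∃ y ∈ H, x = y * b := by
  obtain ⟨z, hz, k, rfl⟩ := (mem_sup_zpowers_of_mem_normalizer h.normalizes).mp hx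
  obtain ⟨m, rfl | rfl⟩ := Int.even_or_odd' k
  · exact Or.inl (Subgroup.mul_mem _ (A_le_H hz) (sq_zpow_mem_H m))
  · refine Or.inr ⟨_, Subgroup.mul_mem _ (A_le_H hz) (sq_zpow_mem_H m), ?_⟩
    rw [zpow_add_one, mul_assoc]

theorem b_conj_mem_H (h : IsRankOneTriple a b g) {x : G} (hx : x ∈ H) (k : ℤ) :
    b ^ k * x * b ^ (-k) ∈ H := by
  obtain ⟨m, z, hz, rfl⟩ := h.mem_H.mp hx
  refine h.mem_H.mpr ⟨m, _, h.zpow_conj_mem hz k, ?_⟩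
  have : b ^ k * b ^ (2 * m) = b ^ (2 * m) * b ^ k := by
    rw [← zpow_add, ← zpow_add, add_comm]
  rw [← mul_assoc, this]
  group

theorem semidirect (h : IsRankOneTriple a b g) :
    IsInternalSemidirect H A (Subgroup.zpowers (b ^ 2)) where
  sup_eq := rfl
  inf_eq := by
    rw [eq_bot_iff, ← h.disjoint]
    exact inf_le_inf_left _
      (Subgroup.zpowers_le.mpr (Subgroup.pow_mem _ (Subgroup.mem_zpowers b) 2))
  normalizes := sup_le Subgroup.le_normalizer
    (Subgroup.zpowers_le.mpr (Subgroup.pow_mem _ h.normalizes 2))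

/-- Replacing `g` by `b * g` gives another such triple. -/
theorem mul_left (h : IsRankOneTriple a b g) : IsRankOneTriple a b (b * g) := by
  have hg : g * b = b⁻¹ * g := by simpa using h.g_mul_zpow 1
  have key : ∀ z : G, b * g * z * (b * g) = g * (b⁻¹ * z * b) * g := fun z => by
    have : b * g = g * b⁻¹ := by simpa using (h.g_mul_zpow (-1)).symm
    calc b * g * z * (b * g) = (b * g) * z * b * g := by group
      _ = g * (b⁻¹ * z * b) * g := by rw [this]; group
  refine { h with mul_self := ?_, inverts := ?_, bruhat := fun x => ?_, generate := ?_ }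
  · rw [mul_assoc, ← mul_assoc g, hg, mul_assoc, h.mul_self]; group
  · rw [key]; simpa using h.inverts
  · refine (h.bruhat x).imp_right ?_
    rintro ⟨y, hy, z, hz, rfl⟩
    refine ⟨y * b⁻¹, Subgroup.mul_mem _ hy (Subgroup.inv_mem _
      (Subgroup.mem_sup_right (Subgroup.mem_zpowers b))), z, hz, by group⟩
  · intro K hA hK
    refine h.generate K hA fun z hz => ?_
    have := hK (b * z * b⁻¹) (by simpa using h.zpow_conj_mem hz 1)
    rw [key] at this
    convert this using 2
    group

theorem mem_doubleCoset (h : IsRankOneTriple a b g) {x : G} :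
    x ∈ D ↔ ∃ y ∈ H, ∃ z ∈ A, x = y * g * z := by
  rw [DoubleCoset.mem_doubleCoset]
  constructor
  · rintro ⟨y, hy, y', hy', rfl⟩
    obtain ⟨k, z, hz, rfl⟩ := h.mem_H.mp hy'
    refine ⟨y * b ^ (2 * (-k)), Subgroup.mul_mem _ hy (sq_zpow_mem_H _), z, hz, ?_⟩
    have := h.g_mul_zpow (2 * k)
    rw [mul_assoc y g, ← mul_assoc g, this, mul_neg]
    group
  · rintro ⟨y, hy, z, hz, rfl⟩
    exact ⟨y, hy, z, A_le_H hz, rfl⟩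

theorem doubleCoset_disjoint_P (h : IsRankOneTriple a b g) {x : G}
    (hx : x ∈ D) : x ∉ P := by
  obtain ⟨y, hy, z, hz, rfl⟩ := h.mem_doubleCoset.mp hx
  intro hm
  rw [mul_assoc, Subgroup.mul_mem_cancel_left _ (H_le_P hy),
    Subgroup.mul_mem_cancel_right _ (H_le_P (A_le_H hz))] at hm
  exact h.g_notMem_P hm

theorem mul_mem_doubleCoset {x y z : G} (hy : y ∈ H)
    (hx : x ∈ D) (hz : z ∈ H) :
    y * x * z ∈ D := by
  rw [DoubleCoset.mem_doubleCoset] at hx ⊢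
  obtain ⟨k, hk, l, hl, rfl⟩ := hx
  exact ⟨y * k, Subgroup.mul_mem _ hy hk, l * z, Subgroup.mul_mem _ hl hz, by group⟩

theorem inv_mem_doubleCoset (h : IsRankOneTriple a b g) {x : G}
    (hx : x ∈ D) :
    x⁻¹ ∈ D := by
  rw [DoubleCoset.mem_doubleCoset] at hx ⊢
  obtain ⟨k, hk, l, hl, rfl⟩ := hx
  exact ⟨l⁻¹, Subgroup.inv_mem _ hl, k⁻¹, Subgroup.inv_mem _ hk, by
    rw [mul_inv_rev, mul_inv_rev, h.inv_g]; group⟩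

/-- Otherwise `gHg ⊆ H ∪ HgH`, so `H ∪ HgH` is closed under products and equals `G`. But `b` lies in
`P` outside `H`, and `HgH` is disjoint from `P`. -/
theorem exists_gzg_notMem (h : IsRankOneTriple a b g) :
    ∃ z ∈ A, z ≠ 1 ∧ g * z * g ∉ D := by
  by_contra! hall
  have hmem : ∀ y ∈ H, g * y * g ∈ H ∨
      g * y * g ∈ D := fun y hy => by
    obtain ⟨k, z, hz, rfl⟩ := h.mem_H.mp hy
    have e : g * (b ^ (2 * k) * z) * g = b ^ (2 * (-k)) * (g * z * g) := by
      rw [← mul_assoc g, h.g_mul_zpow, mul_neg]; group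
    rw [e]
    by_cases hz1 : z = 1
    · left
      simpa [hz1, h.mul_self] using sq_zpow_mem_H (a := a) (b := b) (-k)
    · right
      simpa using mul_mem_doubleCoset (sq_zpow_mem_H (-k)) (hall z hz hz1) (one_mem H)
  let K : Subgroup G :=
    { carrier := {x | x ∈ H ∨ x ∈ D}
      one_mem' := Or.inl (one_mem _)
      inv_mem' := by
        rintro x (hx | hx)
        · exact Or.inl (Subgroup.inv_mem _ hx)
        · exact Or.inr (h.inv_mem_doubleCoset hx)
      mul_mem' := by
        rintro x y (hx | hx) (hy | hy)
        · exact Or.inl (Subgroup.mul_mem _ hx hy)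
        · exact Or.inr (by simpa using mul_mem_doubleCoset hx hy (one_mem H))
        · exact Or.inr (by simpa using mul_mem_doubleCoset (one_mem H) hx hy)
        · rw [DoubleCoset.mem_doubleCoset] at hx hy
          obtain ⟨k, hk, l, hl, rfl⟩ := hx
          obtain ⟨k', hk', l', hl', rfl⟩ := hy
          have e : k * g * l * (k' * g * l') = k * (g * (l * k') * g) * l' := by group
          rw [e]
          refine (hmem _ (Subgroup.mul_mem _ hl hk')).imp (fun hm => ?_) fun hm => ?_
          · exact Subgroup.mul_mem _ (Subgroup.mul_mem _ hk hm) hl'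
          · exact mul_mem_doubleCoset hk hm hl' }
  have hK : K = ⊤ := h.generate K (fun z hz => Or.inl (A_le_H hz))
    fun z hz => hmem z (A_le_H hz)
  have hb : b ∈ K := hK ▸ Subgroup.mem_top b
  rcases hb with hb | hb
  · exact h.b_notMem_H hb
  · exact h.doubleCoset_disjoint_P hb (Subgroup.mem_sup_right (Subgroup.mem_zpowers b))

/-- Outside `P`, the Bruhat decomposition leaves only `HgH` and `HbgH`. The previous lemma applied
to `bg` yields an element avoiding `HbgH`, and `bg = gb⁻¹` rewrites it as some `gz'g`. -/
theorem exists_gzg_mem (h : IsRankOneTriple a b g) :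
    ∃ z ∈ A, z ≠ 1 ∧ g * z * g ∈ D := by
  obtain ⟨z, hz, hz1, hzn⟩ := h.mul_left.exists_gzg_notMem
  have hz' : b⁻¹ * z * b ∈ A := by simpa using h.zpow_conj_mem hz (-1)
  have hz1' : b⁻¹ * z * b ≠ 1 := fun e => hz1 (by
    have : z = b * (b⁻¹ * z * b) * b⁻¹ := by group
    rw [this, e]; group)
  refine ⟨_, hz', hz1', ?_⟩
  have key : b * g * z * (b * g) = g * (b⁻¹ * z * b) * g := by
    have : b * g = g * b⁻¹ := by simpa using (h.g_mul_zpow (-1)).symm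
    calc b * g * z * (b * g) = (b * g) * z * b * g := by group
      _ = g * (b⁻¹ * z * b) * g := by rw [this]; group
  rw [key, h.mul_left.mem_doubleCoset] at hzn
  rcases h.bruhat (g * (b⁻¹ * z * b) * g) with hP | ⟨y, hy, z', hz', e⟩
  · exact absurd hP (h.gzg_notMem_P hz' hz1')
  · rw [e]
    rcases h.mem_P_cases hy with hy | ⟨y, hyH, rfl⟩
    · exact h.mem_doubleCoset.mpr ⟨y, hy, z', hz', rfl⟩
    · exact absurd ⟨y, hyH, z', hz', by rw [e]; group⟩ hzn

theorem sup_zpowers_g (h : IsRankOneTriple a b g) : H ⊔ Subgroup.zpowers g = ⊤ := by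
  have hg : g ∈ H ⊔ Subgroup.zpowers g := Subgroup.mem_sup_right (Subgroup.mem_zpowers g)
  exact h.generate _ (A_le_H.trans le_sup_left) fun z hz =>
    Subgroup.mul_mem _ (Subgroup.mul_mem _ hg (Subgroup.mem_sup_left (A_le_H hz))) hg

/-- Conjugation by `g` shows that the core meets `⟨a⟩` trivially. Commutators of core elements with
`⟨a⟩` lie in both, so the core centralizes `a`; then `faithful` kills the torus part and leaves an
element of `⟨a⟩`. -/
theorem normalCore_eq_bot (h : IsRankOneTriple a b g) : (H).normalCore = ⊥ := by
  have hN : (H).normalCore ≤ H := Subgroup.normalCore_le _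
  have hAN : ∀ z ∈ A, z ∈ (H).normalCore → z = 1 := fun z hz hzN => by
    by_contra hz1
    have hm := (Subgroup.normalCore_normal H).conj_mem z hzN g
    rw [h.inv_g] at hm
    exact h.gzg_notMem_P hz hz1 (H_le_P (hN hm))
  rw [eq_bot_iff]
  intro n hn
  rw [Subgroup.mem_bot]
  have hcomm : ∀ z ∈ A, Commute n z := fun z hz => by
    have h1 : n * z * n⁻¹ ∈ A :=
      (Subgroup.mem_normalizer_iff.mp (h.semidirect.normalizes (hN hn)) z).mp hz
    have h2 : n * z * n⁻¹ * z⁻¹ ∈ A := Subgroup.mul_mem _ h1 (Subgroup.inv_mem _ hz)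
    have h3 : n * z * n⁻¹ * z⁻¹ ∈ (H).normalCore := by
      have := Subgroup.mul_mem _ hn ((Subgroup.normalCore_normal H).conj_mem n⁻¹
        (Subgroup.inv_mem _ hn) z)
      convert this using 1
      group
    have := hAN _ h2 h3
    rw [mul_inv_eq_one, mul_inv_eq_iff_eq_mul] at this
    exact this
  obtain ⟨k, z, hz, e⟩ := h.mem_H.mp (hN hn)
  have hb : b ^ (2 * k) = 1 := by
    refine h.faithful _ ⟨2 * k, rfl⟩ ?_
    have : b ^ (2 * k) = n * z⁻¹ := by rw [e]; group
    rw [this]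
    refine (hcomm a (Subgroup.mem_zpowers a)).mul_left ?_
    obtain ⟨m, rfl⟩ := hz
    exact ((Commute.refl a).zpow_left m).inv_left
  rw [hb, one_mul] at e
  exact e ▸ hAN z hz (e ▸ hn)

theorem isCosetDatum (h : IsRankOneTriple a b g) : IsCosetDatum H g where
  core_free := h.normalCore_eq_bot
  proper := fun e => h.b_notMem_H (e ▸ Subgroup.mem_top b)
  generates := h.sup_zpowers_g
  sq_mem := by rw [pow_two g, h.mul_self]; exact one_mem _

end IsRankOneTriple

end Abstract

/-! ### Automorphisms and connectedness of coset graphs. -/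

section CosetGraph

variable {G : Type*} [Group G]

/-- The automorphism of a coset graph induced by a permutation of the group which preserves the
relations defining right cosets and adjacency. -/
def cosetGraphIso (H : Subgroup G) (g : G) (hd : IsCosetDatum H g) (e : G ≃ G)
    (h1 : ∀ x y, y * x⁻¹ ∈ H ↔ e y * (e x)⁻¹ ∈ H)
    (h2 : ∀ x y, y * x⁻¹ ∈ DoubleCoset.doubleCoset g (H : Set G) (H : Set G) ↔
      e y * (e x)⁻¹ ∈ DoubleCoset.doubleCoset g (H : Set G) (H : Set G)) :
    cosetGraph H g hd ≃g cosetGraph H g hd where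
  toEquiv := Quotient.congr e fun x y => by
    change QuotientGroup.rightRel H x y ↔ QuotientGroup.rightRel H (e x) (e y)
    rw [QuotientGroup.rightRel_apply, QuotientGroup.rightRel_apply, h1]
  map_rel_iff' := by
    intro U V
    induction U using Quotient.inductionOn
    induction V using Quotient.inductionOn
    simp only [Quotient.congr_mk, cosetGraph_adj_mk]
    exact (h2 _ _).symm

/-- Right translation by `y`, as an automorphism of a coset graph. -/
def cosetGraphTranslation (H : Subgroup G) (g : G) (hd : IsCosetDatum H g) (y : G) :
    cosetGraph H g hd ≃g cosetGraph H g hd :=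
  cosetGraphIso H g hd (Equiv.mulRight y) (fun u v => by simp) (fun u v => by simp)

@[simp]
theorem cosetGraphTranslation_mk (H : Subgroup G) (g : G) (hd : IsCosetDatum H g) (x y : G) :
    cosetGraphTranslation H g hd y (Quotient.mk (QuotientGroup.rightRel H) x) =
      Quotient.mk (QuotientGroup.rightRel H) (x * y) := rfl

theorem cosetGraph_connected (H : Subgroup G) (g : G) (hd : IsCosetDatum H g) :
    (cosetGraph H g hd).Connected := by
  have htrans : ∀ x y z : G, (cosetGraph H g hd).Reachable
      (Quotient.mk (QuotientGroup.rightRel H) x) (Quotient.mk (QuotientGroup.rightRel H) y) →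
      (cosetGraph H g hd).Reachable (Quotient.mk (QuotientGroup.rightRel H) (x * z))
        (Quotient.mk (QuotientGroup.rightRel H) (y * z)) := fun x y z hxy => by
    simpa using hxy.map (cosetGraphTranslation H g hd z).toHom
  -- Right translations make the elements `k` with `Hk` reachable from `H` a subgroup; it contains
  -- `H` and `g`.
  let K : Subgroup G :=
    { carrier := {k | (cosetGraph H g hd).Reachable (Quotient.mk (QuotientGroup.rightRel H) 1)
        (Quotient.mk (QuotientGroup.rightRel H) k)}
      one_mem' := SimpleGraph.Reachable.refl _
      inv_mem' := fun {x} hx => by simpa using (htrans _ _ x⁻¹ hx).symm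
      mul_mem' := fun {x y} hx hy => hy.trans (by simpa using htrans _ _ y hx) }
  have hK : K = ⊤ := by
    rw [eq_top_iff, ← hd.generates, sup_le_iff, Subgroup.zpowers_le]
    constructor
    · intro x hx
      have : Quotient.mk (QuotientGroup.rightRel H) 1 =
          Quotient.mk (QuotientGroup.rightRel H) x :=
        Quotient.sound (QuotientGroup.rightRel_apply.mpr (by simpa using hx))
      change (cosetGraph H g hd).Reachable _ _
      rw [this]
    · refine SimpleGraph.Adj.reachable ((cosetGraph_adj_mk H g hd 1 g).mpr ?_)
      exact DoubleCoset.mem_doubleCoset.mpr ⟨1, one_mem _, 1, one_mem _, by simp⟩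
  have hone : ∀ V, (cosetGraph H g hd).Reachable
      (Quotient.mk (QuotientGroup.rightRel H) 1) V := fun V => by
    induction V using Quotient.inductionOn with | h x =>
    exact (hK ▸ Subgroup.mem_top x : x ∈ K)
  have : Nonempty (Quotient (QuotientGroup.rightRel H)) := ⟨Quotient.mk _ 1⟩
  exact ⟨fun U V => (hone U).symm.trans (hone V)⟩

end CosetGraph

/-! ### Arcs and geodesics of the coset graph. -/

namespace IsRankOneTriple

variable {G : Type*} [Group G] {a b g : G}

local notation "A" => Subgroup.zpowers a
local notation "H" => Subgroup.zpowers a ⊔ Subgroup.zpowers (b ^ 2)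
local notation "D" => DoubleCoset.doubleCoset g
  ((Subgroup.zpowers a ⊔ Subgroup.zpowers (b ^ 2) : Subgroup G) : Set G)
  ((Subgroup.zpowers a ⊔ Subgroup.zpowers (b ^ 2) : Subgroup G) : Set G)
local notation "mk" => Quotient.mk
  (QuotientGroup.rightRel (Subgroup.zpowers a ⊔ Subgroup.zpowers (b ^ 2)))

variable (hd : IsCosetDatum (Subgroup.zpowers a ⊔ Subgroup.zpowers (b ^ 2)) g)

local notation "Γ" => cosetGraph (Subgroup.zpowers a ⊔ Subgroup.zpowers (b ^ 2)) g hd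

theorem adj_iff (h : IsRankOneTriple a b g) (x : G) (V) :
    (Γ).Adj (mk x) V ↔ ∃ z ∈ A, V = mk (g * z * x) := by
  induction V using Quotient.inductionOn with | h y =>
  rw [cosetGraph_adj_mk, h.mem_doubleCoset]
  constructor
  · rintro ⟨u, hu, z, hz, e⟩
    refine ⟨z, hz, Quotient.sound (QuotientGroup.rightRel_apply.mpr ?_)⟩
    have : g * z * x * y⁻¹ = u⁻¹ := by
      have : y = u * g * z * x := by rw [← e]; group
      rw [this]; group
    rw [this]
    exact Subgroup.inv_mem _ hu
  · rintro ⟨z, hz, e⟩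
    have := QuotientGroup.rightRel_apply.mp (Quotient.exact e)
    exact ⟨_, Subgroup.inv_mem _ this, z, hz, by group⟩

theorem mk_gzx_injective (h : IsRankOneTriple a b g) (x : G) {z z' : G} (hz : z ∈ A)
    (hz' : z' ∈ A) (e : mk (g * z * x) = mk (g * z' * x)) : z = z' := by
  have hm := QuotientGroup.rightRel_apply.mp (Quotient.exact e)
  have e' : g * z' * x * (g * z * x)⁻¹ = g * (z' * z⁻¹) * g := by
    rw [mul_inv_rev, mul_inv_rev, h.inv_g]; group
  rw [e'] at hm
  by_contra hne
  refine h.gzg_notMem_P (Subgroup.mul_mem _ hz' (Subgroup.inv_mem _ hz)) (fun e1 => hne ?_)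
    (H_le_P hm)
  exact (mul_inv_eq_one.mp e1).symm

theorem ncard_neighborSet (h : IsRankOneTriple a b g) (V) :
    ((Γ).neighborSet V).ncard = orderOf a := by
  induction V using Quotient.inductionOn with | h x =>
  have : (Γ).neighborSet (mk x) = (fun z => mk (g * z * x)) '' (A : Set G) := by
    ext V
    rw [SimpleGraph.mem_neighborSet, h.adj_iff hd]
    simp only [Set.mem_image, SetLike.mem_coe]
    exact exists_congr fun z => and_congr_right fun _ => eq_comm
  rw [this, Set.InjOn.ncard_image fun z hz z' hz' e => h.mk_gzx_injective x hz hz' e,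
    ← Nat.card_coe_set_eq]
  exact Nat.card_zpowers a

/-- Conjugation by a power of `b`, as an automorphism of the coset graph. -/
def conjIso (h : IsRankOneTriple a b g) (k : ℤ) : Γ ≃g Γ :=
  cosetGraphIso _ g hd (MulAut.conj (b ^ k)).toEquiv
    (fun x y => by
      change _ ↔ MulAut.conj (b ^ k) y * (MulAut.conj (b ^ k) x)⁻¹ ∈ _
      rw [← map_inv, ← map_mul, MulAut.conj_apply]
      constructor
      · intro hm
        simpa using h.b_conj_mem_H hm k
      · intro hm
        convert h.b_conj_mem_H hm (-k) using 1
        group)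
    (fun x y => by
      change _ ↔ MulAut.conj (b ^ k) y * (MulAut.conj (b ^ k) x)⁻¹ ∈ _
      rw [← map_inv, ← map_mul, MulAut.conj_apply]
      have key : ∀ (k : ℤ) (x : G), x ∈ D → b ^ k * x * b ^ (-k) ∈ D := fun k x hx => by
        obtain ⟨y, hy, z, hz, rfl⟩ := h.mem_doubleCoset.mp hx
        -- Conjugation by `b ^ k` turns `g` into `b ^ (2k) * g`, and the extra even power lies in
        -- `H` even when `b ^ k` does not.
        refine h.mem_doubleCoset.mpr ⟨b ^ k * y * b ^ (-k) * b ^ (2 * k),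
          Subgroup.mul_mem _ (h.b_conj_mem_H hy k) (sq_zpow_mem_H k), b ^ k * z * b ^ (-k),
          h.zpow_conj_mem hz k, ?_⟩
        have e := h.g_mul_zpow (-k)
        rw [neg_neg] at e
        calc b ^ k * (y * g * z) * b ^ (-k)
            = b ^ k * y * (g * b ^ (-k)) * (b ^ k * z * b ^ (-k)) := by group
          _ = b ^ k * y * b ^ k * g * (b ^ k * z * b ^ (-k)) := by rw [e]; group
          _ = _ := by
            have : b ^ (-k) * b ^ (2 * k) = b ^ k := by rw [← zpow_add]; congr 1; ring
            rw [mul_assoc (b ^ k * y) (b ^ (-k)), this]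
      constructor
      · intro hm
        simpa using key k _ hm
      · intro hm
        convert key (-k) _ hm using 1
        group)

theorem conjIso_mk (h : IsRankOneTriple a b g) (k : ℤ) (x : G) :
    h.conjIso hd k (mk x) = mk (b ^ k * x * (b ^ k)⁻¹) := rfl

theorem conjIso_one (h : IsRankOneTriple a b g) (k : ℤ) : h.conjIso hd k (mk 1) = mk 1 := by
  rw [conjIso_mk]; simp

theorem conjIso_gz (h : IsRankOneTriple a b g) (k : ℤ) (z : G) :
    h.conjIso hd k (mk (g * z)) = mk (g * (b ^ k * z * b ^ (-k))) := by
  rw [conjIso_mk]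
  refine Quotient.sound (QuotientGroup.rightRel_apply.mpr ?_)
  have e : b ^ k * (g * z) * (b ^ k)⁻¹ = b ^ (2 * k) * (g * (b ^ k * z * b ^ (-k))) := by
    rw [← mul_assoc g, ← mul_assoc g, h.g_mul_zpow, zpow_neg, two_mul, zpow_add]
    group
  rw [e, mul_inv_rev, ← mul_assoc, mul_inv_cancel, one_mul]
  exact Subgroup.inv_mem _ (sq_zpow_mem_H k)

/-- Every pair of adjacent vertices is equivalent to `(Hg, H)`. -/
theorem exists_iso_of_adj (h : IsRankOneTriple a b g) {U V} (hUV : (Γ).Adj U V) :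
    ∃ σ : Γ ≃g Γ, σ U = mk g ∧ σ V = mk 1 := by
  induction V using Quotient.inductionOn with | h x =>
  obtain ⟨z, hz, rfl⟩ := (h.adj_iff hd x U).mp hUV.symm
  refine ⟨cosetGraphTranslation _ g hd (x⁻¹ * z⁻¹), ?_, ?_⟩
  · rw [cosetGraphTranslation_mk]
    congr 1
    group
  · rw [cosetGraphTranslation_mk]
    refine Quotient.sound (QuotientGroup.rightRel_apply.mpr ?_)
    simpa using A_le_H hz

/-- Every 2-arc is equivalent to `(Hg, H, Hgz)` for some nontrivial `z ∈ ⟨a⟩`. -/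
theorem exists_iso_of_arc (h : IsRankOneTriple a b g) {U V W} (hUV : (Γ).Adj U V)
    (hVW : (Γ).Adj V W) (hUW : U ≠ W) :
    ∃ z ∈ A, z ≠ 1 ∧ ∃ σ : Γ ≃g Γ, σ U = mk g ∧ σ V = mk 1 ∧ σ W = mk (g * z) := by
  obtain ⟨σ, hU, hV⟩ := h.exists_iso_of_adj hd hUV
  have hW : (Γ).Adj (mk 1) (σ W) := hV ▸ σ.map_adj_iff.mpr hVW
  obtain ⟨z, hz, e⟩ := (h.adj_iff hd 1 _).mp hW
  rw [mul_one] at e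
  refine ⟨z, hz, fun hz1 => hUW (σ.injective ?_), σ, hU, hV, e⟩
  rw [e, hU, hz1, mul_one]

theorem adj_g_gz (h : IsRankOneTriple a b g) (z : G) :
    (Γ).Adj (mk g) (mk (g * z)) ↔ g * z * g ∈ D := by
  rw [cosetGraph_adj_mk, h.inv_g]

theorem adj_one_gz (h : IsRankOneTriple a b g) {z : G} (hz : z ∈ A) :
    (Γ).Adj (mk 1) (mk (g * z)) :=
  (h.adj_iff hd 1 _).mpr ⟨z, hz, by rw [mul_one]⟩

theorem adj_conj_iff (h : IsRankOneTriple a b g) (k : ℤ) (z : G) :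
    (Γ).Adj (mk g) (mk (g * (b ^ k * z * b ^ (-k)))) ↔ (Γ).Adj (mk g) (mk (g * z)) := by
  have hg : h.conjIso hd k (mk g) = mk g := by
    have := h.conjIso_gz hd k 1
    simpa using this
  rw [← h.conjIso_gz hd k z]
  nth_rewrite 1 [← hg]
  exact (h.conjIso hd k).map_adj_iff

/-- Pigeonhole: take `x` with `Hgx` adjacent to `Hg`. Two of `x`, `y`, `z` are conjugate under
`⟨b⟩`, and since such conjugation preserves adjacency to `Hg`, they must be `y` and `z`. -/
theorem exists_iso_of_not_adj (h : IsRankOneTriple a b g) {y z : G} (hy : y ∈ A) (hz : z ∈ A)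
    (hy1 : y ≠ 1) (hz1 : z ≠ 1) (hyn : ¬ (Γ).Adj (mk g) (mk (g * y)))
    (hzn : ¬ (Γ).Adj (mk g) (mk (g * z))) :
    ∃ σ : Γ ≃g Γ, σ (mk g) = mk g ∧ σ (mk 1) = mk 1 ∧ σ (mk (g * y)) = mk (g * z) := by
  obtain ⟨x, hx, hx1, hxD⟩ := h.exists_gzg_mem
  have hxa := (h.adj_g_gz hd x).mpr hxD
  rcases h.orbits x hx y hy z hz hx1 hy1 hz1 with ⟨k, rfl⟩ | ⟨k, rfl⟩ | ⟨k, rfl⟩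
  · exact absurd ((h.adj_conj_iff hd k x).mpr hxa) hyn
  · exact absurd ((h.adj_conj_iff hd k x).mpr hxa) hzn
  · exact ⟨h.conjIso hd k, by simpa using h.conjIso_gz hd k 1, h.conjIso_one hd k,
      h.conjIso_gz hd k y⟩

theorem isGeodesicTransitive [Finite G] (h : IsRankOneTriple a b g) :
    IsGeodesicTransitive Γ 2 := by
  have hconn := cosetGraph_connected _ g hd
  refine ⟨hconn, ?_, ?_⟩
  · obtain ⟨z, hz, hz1, hzD⟩ := h.exists_gzg_notMem
    have : Nonempty (Quotient (QuotientGroup.rightRel (H))) := ⟨mk 1⟩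
    -- Finiteness rules out an infinite `ediam`, for which `diam` would take the default value 0.
    refine le_trans ?_ (SimpleGraph.dist_le_diam
      (SimpleGraph.connected_iff_ediam_ne_top.mp hconn) (u := mk g) (v := mk (g * z)))
    have h0 : (Γ).dist (mk g) (mk (g * z)) ≠ 0 := fun e => by
      have e' := (hconn.dist_eq_zero_iff).mp e
      exact hz1 (h.mk_gzx_injective 1 (one_mem _) hz (by simpa using e')).symm
    have h1 : (Γ).dist (mk g) (mk (g * z)) ≠ 1 := fun e =>
      hzD ((h.adj_g_gz hd z).mp (SimpleGraph.dist_eq_one_iff_adj.mp e))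
    omega
  · intro t ht1 ht2 v w hv hw
    obtain rfl | rfl : t = 1 ∨ t = 2 := by omega
    · obtain ⟨σ, hσ0, hσ1⟩ := h.exists_iso_of_adj hd (hv.1 0)
      obtain ⟨τ, hτ0, hτ1⟩ := h.exists_iso_of_adj hd (hw.1 0)
      refine ⟨σ.trans τ.symm, fun i => ?_⟩
      rw [RelIso.trans_apply, RelIso.symm_apply_eq]
      fin_cases i
      · exact hσ0.trans hτ0.symm
      · exact hσ1.trans hτ1.symm
    · have hna : ∀ u : Fin 3 → Quotient (QuotientGroup.rightRel (H)), IsGeodesicSeq Γ u →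
          ¬ (Γ).Adj (u 0) (u 2) := fun u hu hadj => by
        have h2 : (Γ).dist (u 0) (u 2) = 2 := hu.2.2
        rw [SimpleGraph.dist_eq_one_iff_adj.mpr hadj] at h2
        omega
      obtain ⟨y, hy, hy1, σ, hσ0, hσ1, hσ2⟩ := h.exists_iso_of_arc hd (hv.1 0) (hv.1 1)
        (fun e => absurd (hv.2.1 e) (by decide))
      obtain ⟨z, hz, hz1, τ, hτ0, hτ1, hτ2⟩ := h.exists_iso_of_arc hd (hw.1 0) (hw.1 1)
        (fun e => absurd (hw.2.1 e) (by decide))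
      have hyn : ¬ (Γ).Adj (mk g) (mk (g * y)) := fun hadj => by
        rw [← hσ0, ← hσ2, σ.map_adj_iff] at hadj
        exact hna v hv hadj
      have hzn : ¬ (Γ).Adj (mk g) (mk (g * z)) := fun hadj => by
        rw [← hτ0, ← hτ2, τ.map_adj_iff] at hadj
        exact hna w hw hadj
      obtain ⟨ρ, hρ0, hρ1, hρ2⟩ := h.exists_iso_of_not_adj hd hy hz hy1 hz1 hyn hzn
      refine ⟨(σ.trans ρ).trans τ.symm, fun i => ?_⟩
      rw [RelIso.trans_apply, RelIso.symm_apply_eq, RelIso.trans_apply]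
      fin_cases i
      · exact (congrArg ρ hσ0).trans (hρ0.trans hτ0.symm)
      · exact (congrArg ρ hσ1).trans (hρ1.trans hτ1.symm)
      · exact (congrArg ρ hσ2).trans (hρ2.trans hτ2.symm)

/-- One 2-arc has adjacent ends and another does not, so no automorphism relates them. -/
theorem not_isArcTransitive (h : IsRankOneTriple a b g) : ¬ IsArcTransitive Γ 2 := by
  intro htrans
  have harc : ∀ z ∈ A, z ≠ 1 → IsArcSeq Γ (s := 2) ![mk g, mk 1, mk (g * z)] := by
    intro z hz hz1
    refine ⟨fun i => ?_, fun i j hij => ?_⟩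
    · fin_cases i
      · simpa using (h.adj_one_gz hd (one_mem A)).symm
      · exact h.adj_one_gz hd hz
    · have hi : i = 0 := by ext; simp; omega
      have hj : j = 2 := by ext; simp; omega
      subst hi hj
      intro e
      exact hz1 (h.mk_gzx_injective 1 (one_mem _) hz (by simpa using e)).symm
  obtain ⟨y, hy, hy1, hyD⟩ := h.exists_gzg_mem
  obtain ⟨z, hz, hz1, hzD⟩ := h.exists_gzg_notMem
  obtain ⟨σ, hσ⟩ := htrans 2 (by norm_num) le_rfl _ _ (harc y hy hy1) (harc z hz hz1)
  have h0 : σ (mk g) = mk g := hσ 0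
  have h2 : σ (mk (g * y)) = mk (g * z) := hσ 2
  refine hzD ((h.adj_g_gz hd z).mp ?_)
  rw [← h0, ← h2, σ.map_adj_iff]
  exact (h.adj_g_gz hd y).mpr hyD

end IsRankOneTriple

/-! ### Matrix computations in `SL(2, F)`. -/

namespace SL2

variable {F : Type*} [Field F]

local notation "SL" => Matrix.SpecialLinearGroup (Fin 2) F

theorem ext_entries {M N : SL} : M = N ↔
    M 0 0 = N 0 0 ∧ M 0 1 = N 0 1 ∧ M 1 0 = N 1 0 ∧ M 1 1 = N 1 1 := by
  refine ⟨fun h => by simp [h], fun ⟨h1, h2, h3, h4⟩ => ?_⟩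
  ext i j
  fin_cases i <;> fin_cases j <;> assumption

theorem mul_entry (M N : SL) (i j : Fin 2) : (M * N) i j = M i 0 * N 0 j + M i 1 * N 1 j := by
  exact (Matrix.mul_apply (M := M.1) (N := N.1)).trans (Fin.sum_univ_two _)

theorem neg_entry (M : SL) (i j : Fin 2) : (-M) i j = -(M i j) := by
  rfl

theorem det_entries (M : SL) : M 0 0 * M 1 1 - M 0 1 * M 1 0 = 1 := by
  rw [← Matrix.det_fin_two]; exact M.2

/-- The upper unipotent matrix with entry `x`. -/
def unip (x : F) : SL := ⟨!![1, x; 0, 1], by simp⟩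

/-- The lower unipotent matrix with entry `x`. -/
def lower (x : F) : SL := ⟨!![1, 0; x, 1], by simp⟩

/-- The diagonal matrix with entries `s`, `s⁻¹`. -/
def torus (s : Fˣ) : SL := ⟨!![(s : F), 0; 0, (s : F)⁻¹], by simp⟩

/-- The antidiagonal matrix with entries `s`, `-s⁻¹`. -/
def anti (s : Fˣ) : SL := ⟨!![0, (s : F); -(s : F)⁻¹, 0], by simp⟩

section entries
variable (x : F) (s : Fˣ)
@[simp] theorem unip_00 : unip x 0 0 = 1 := rfl
@[simp] theorem unip_01 : unip x 0 1 = x := rfl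
@[simp] theorem unip_10 : unip x 1 0 = 0 := rfl
@[simp] theorem unip_11 : unip x 1 1 = 1 := rfl
@[simp] theorem lower_00 : lower x 0 0 = 1 := rfl
@[simp] theorem lower_01 : lower x 0 1 = 0 := rfl
@[simp] theorem lower_10 : lower x 1 0 = x := rfl
@[simp] theorem lower_11 : lower x 1 1 = 1 := rfl
@[simp] theorem torus_00 : torus s 0 0 = s := rfl
@[simp] theorem torus_01 : torus s 0 1 = 0 := rfl
@[simp] theorem torus_10 : torus s 1 0 = 0 := rfl
@[simp] theorem torus_11 : torus s 1 1 = (s : F)⁻¹ := rfl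
@[simp] theorem anti_00 : anti s 0 0 = 0 := rfl
@[simp] theorem anti_01 : anti s 0 1 = s := rfl
@[simp] theorem anti_10 : anti s 1 0 = -(s : F)⁻¹ := rfl
@[simp] theorem anti_11 : anti s 1 1 = 0 := rfl
end entries

theorem unip_mul (x y : F) : unip x * unip y = unip (x + y) := by
  rw [ext_entries]; simp [mul_entry, add_comm]

theorem unip_zero : unip (0 : F) = 1 := by
  rw [ext_entries]; simp

theorem torus_mul (s t : Fˣ) : torus s * torus t = torus (s * t) := by
  rw [ext_entries]; simp [mul_entry, mul_comm]

theorem torus_one : torus (1 : Fˣ) = 1 := by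
  rw [ext_entries]; simp

theorem torus_neg (s : Fˣ) : torus (-s) = -torus s := by
  rw [ext_entries]; simp [neg_entry, inv_neg]

theorem torus_zpow (s : Fˣ) (k : ℤ) : torus s ^ k = torus (s ^ k) :=
  (map_zpow (⟨⟨torus, torus_one⟩, fun s t => (torus_mul s t).symm⟩ : Fˣ →* SL) s k).symm

theorem torus_inv (s : Fˣ) : (torus s)⁻¹ = torus s⁻¹ := by
  simpa using torus_zpow s (-1)

theorem unip_zpow (x : F) (k : ℤ) : unip x ^ k = unip (k * x) := by
  have := map_zpow (⟨⟨fun y => unip y.toAdd, unip_zero⟩, fun y z => (unip_mul _ _).symm⟩ :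
    Multiplicative F →* SL) (Multiplicative.ofAdd x) k
  rw [← ofAdd_zsmul] at this
  simpa using this.symm

theorem unip_inv (x : F) : (unip x)⁻¹ = unip (-x) := by
  simpa using unip_zpow x (-1)

theorem torus_conj_unip (s : Fˣ) (x : F) :
    torus s * unip x * (torus s)⁻¹ = unip (s ^ 2 * x) := by
  rw [mul_inv_eq_iff_eq_mul, ext_entries]
  simp [mul_entry]
  field_simp

theorem unip_conj_torus (s : Fˣ) (r : F) :
    unip r * torus s * (unip r)⁻¹ = torus s * unip (r * ((s : F)⁻¹ ^ 2 - 1)) := by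
  rw [mul_inv_eq_iff_eq_mul, ext_entries]
  simp [mul_entry]
  field_simp
  ring

theorem anti_mul_anti (c : Fˣ) : anti c * anti c = -1 := by
  rw [ext_entries]; simp [mul_entry, neg_entry]

theorem anti_mul_torus_mul_anti (c s : Fˣ) : anti c * torus s * anti c = -torus s⁻¹ := by
  rw [ext_entries]
  simp [mul_entry, neg_entry]
  constructor <;> field_simp

theorem anti_mul_unip_mul_anti (c : Fˣ) (x : F) :
    anti c * unip x * anti c = -lower (-(x * ((c : F)⁻¹) ^ 2)) := by
  rw [ext_entries]
  simp [mul_entry, neg_entry]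
  ring

theorem torus_mul_anti_one (v : Fˣ) : torus v * anti 1 = anti v := by
  rw [ext_entries]; simp [mul_entry]

theorem eq_torus_mul_unip {M : SL} (h : M 1 0 = 0) :
    ∃ (s : Fˣ) (x : F), M = torus s * unip x := by
  have hd := det_entries M
  rw [h, mul_zero, sub_zero] at hd
  refine ⟨⟨M 0 0, M 1 1, hd, by rw [mul_comm, hd]⟩, M 1 1 * M 0 1, ?_⟩
  have h0 : M 0 0 ≠ 0 := left_ne_zero_of_mul_eq_one hd
  rw [ext_entries]
  simp [mul_entry, h]
  exact ⟨by rw [← mul_assoc, hd, one_mul], eq_inv_of_mul_eq_one_right hd⟩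

theorem eq_torus {M : SL} (h : M 1 0 = 0) (h' : M 0 1 = 0) : ∃ s : Fˣ, M = torus s := by
  obtain ⟨s, x, rfl⟩ := eq_torus_mul_unip h
  have : x = 0 := by simpa [mul_entry] using h'
  exact ⟨s, by rw [this, unip_zero, mul_one]⟩

theorem eq_anti {M : SL} (h : M 0 0 = 0) (h' : M 1 1 = 0) : ∃ s : Fˣ, M = anti s := by
  have hd := det_entries M
  rw [h, zero_mul, zero_sub, ← mul_neg] at hd
  refine ⟨⟨M 0 1, -M 1 0, hd, by rw [mul_comm, hd]⟩, ?_⟩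
  rw [ext_entries]
  simp only [anti_00, anti_01, anti_10, anti_11, h, h', true_and, and_true]
  rw [← eq_inv_of_mul_eq_one_right hd, neg_neg]

/-- The big Bruhat cell, with `c` arbitrary because `g` is determined only up to the torus. -/
theorem eq_torus_unip_anti_unip (c : Fˣ) {M : SL} (h : M 1 0 ≠ 0) :
    ∃ (s : Fˣ) (x y : F), M = torus s * unip x * anti c * unip y := by
  have hd := det_entries M
  refine ⟨Units.mk0 (-(M 1 0 * c)⁻¹) (by simp [h]), M 0 0 * M 1 0 * c ^ 2,
    M 1 1 * (M 1 0)⁻¹, ?_⟩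
  rw [ext_entries]
  simp [mul_entry]
  field_simp
  refine ⟨trivial, ?_, trivial⟩
  linear_combination -hd

theorem eq_unip_lower_unip {M : SL} (h : M 1 0 ≠ 0) :
    ∃ x y z : F, M = unip x * lower y * unip z := by
  have hd := det_entries M
  refine ⟨(M 0 0 - 1) * (M 1 0)⁻¹, M 1 0, (M 1 1 - 1) * (M 1 0)⁻¹, ?_⟩
  rw [ext_entries]
  simp [mul_entry]
  refine ⟨by field_simp; ring, ?_, by field_simp; ring⟩
  field_simp
  linear_combination -hd

theorem mem_of_unip_lower {K : Subgroup SL} (h1 : ∀ x, unip x ∈ K) (h2 : ∀ x, lower x ∈ K)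
    (M : SL) : M ∈ K := by
  have key : ∀ M : SL, M 1 0 ≠ 0 → M ∈ K := fun M hM => by
    obtain ⟨x, y, z, rfl⟩ := eq_unip_lower_unip hM
    exact K.mul_mem (K.mul_mem (h1 _) (h2 _)) (h1 _)
  by_cases hM : M 1 0 = 0
  · have hd := det_entries M
    rw [hM, mul_zero, sub_zero] at hd
    have h0 : M 0 0 ≠ 0 := left_ne_zero_of_mul_eq_one hd
    -- Left multiplication by `lower 1` changes the lower-left entry from 0 to `M 0 0 ≠ 0`.
    rw [← K.mul_mem_cancel_left (h2 1)]
    exact key _ (by simpa [mul_entry, hM] using h0)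
  · exact key M hM

theorem mem_center_iff {M : SL} : M ∈ Subgroup.center SL ↔ M = 1 ∨ M = -1 := by
  rw [Matrix.SpecialLinearGroup.mem_center_iff]
  constructor
  · rintro ⟨r, hr, hM⟩
    rw [Fintype.card_fin, sq_eq_one_iff] at hr
    refine hr.imp ?_ ?_ <;> rintro rfl <;> ext i j <;> rw [← hM] <;> fin_cases i <;>
      fin_cases j <;> simp
  · rintro (rfl | rfl)
    · exact ⟨1, by simp, by simp⟩
    · exact ⟨-1, by simp, by ext i j; fin_cases i <;> fin_cases j <;> simp⟩

/-- A surjective homomorphism from `SL(2, F)` with kernel `{1, -1}`. -/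
structure IsProjection {G : Type*} [Group G] (ψ : SL →* G) : Prop where
  surjective : Function.Surjective ψ
  eq_one_iff : ∀ M, ψ M = 1 ↔ M = 1 ∨ M = -1

theorem isProjection_mk : IsProjection (QuotientGroup.mk' (Subgroup.center SL)) where
  surjective := QuotientGroup.mk'_surjective _
  eq_one_iff M := by
    rw [QuotientGroup.mk'_apply, QuotientGroup.eq_one_iff, mem_center_iff]

namespace IsProjection

variable {G : Type*} [Group G] {ψ : Matrix.SpecialLinearGroup (Fin 2) F →* G}

theorem eq_iff (hψ : IsProjection ψ) {M N : SL} : ψ M = ψ N ↔ M = N ∨ M = -N := by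
  rw [← mul_inv_eq_one, ← map_inv, ← map_mul, hψ.eq_one_iff, mul_inv_eq_one,
    mul_inv_eq_iff_eq_mul, neg_one_mul]

theorem map_neg (hψ : IsProjection ψ) (M : SL) : ψ (-M) = ψ M :=
  hψ.eq_iff.mpr (Or.inr rfl)

/-- Absorbs a change of basis into the projection, so that given elements can be put in standard
form without being moved in `G`. -/
theorem comp_conj (hψ : IsProjection ψ) (N : SL) :
    IsProjection (ψ.comp (MulAut.conj N).toMonoidHom) where
  surjective := hψ.surjective.comp (MulAut.conj N).surjective
  eq_one_iff M := by
    change ψ (N * M * N⁻¹) = 1 ↔ _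
    rw [hψ.eq_one_iff, mul_inv_eq_one, mul_inv_eq_iff_eq_mul, neg_one_mul]
    constructor <;> rintro (h | h)
    · left; simpa using h
    · right
      rw [← mul_right_inj N, h, mul_neg, mul_one]
    · left; simp [h]
    · right; rw [h, mul_neg, mul_one]

theorem comp_conj_apply {N M : SL} :
    ψ.comp (MulAut.conj N).toMonoidHom M = ψ (N * M * N⁻¹) := rfl

end IsProjection

end SL2

/-! ### Recognition of dihedral groups. -/

theorem nonempty_mulEquiv_dihedralGroup {G : Type*} [Group G] {b g : G} {n : ℕ}
    (hb : orderOf b = n) (hg : g * g = 1) (hgb : g * b * g = b⁻¹)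
    (hgn : g ∉ Subgroup.zpowers b) :
    Nonempty (↥(Subgroup.zpowers b ⊔ Subgroup.zpowers g) ≃* DihedralGroup n) := by
  have hginv : g⁻¹ = g := inv_eq_of_mul_eq_one_left hg
  have hcomm : ∀ k : ℤ, b ^ k * g = g * b ^ (-k) := fun k => by
    have e : g * b * g⁻¹ = b⁻¹ := by rw [hginv, hgb]
    have := conj_zpow (i := -k) (a := g) (b := b)
    rw [e, inv_zpow, zpow_neg, inv_inv] at this
    rw [this, zpow_neg]
    group
  let φ : ZMod n → G := fun i => b ^ (i.cast : ℤ)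
  have hφ : ∀ k : ℤ, φ (k : ZMod n) = b ^ k := fun k => by
    change b ^ _ = b ^ _
    rw [zpow_eq_zpow_iff_modEq, hb, ← ZMod.intCast_eq_intCast_iff, ZMod.intCast_zmod_cast]
  have hadd : ∀ i j, φ (i + j) = φ i * φ j := fun i j => by
    obtain ⟨i, rfl⟩ := ZMod.intCast_surjective i
    obtain ⟨j, rfl⟩ := ZMod.intCast_surjective j
    rw [← Int.cast_add, hφ, hφ, hφ, zpow_add]
  have hsub : ∀ i j, φ (j - i) = φ (-i) * φ j := fun i j => by
    rw [sub_eq_neg_add, hadd]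
  have hneg : ∀ i, φ i * g = g * φ (-i) := fun i => by
    obtain ⟨i, rfl⟩ := ZMod.intCast_surjective i
    rw [← Int.cast_neg, hφ, hφ, hcomm]
  have hmem : ∀ i, φ i ∈ Subgroup.zpowers b := fun i => ⟨_, rfl⟩
  have h0 : φ 0 = 1 := by simpa using hφ 0
  let f : DihedralGroup n →* G :=
    { toFun := fun x => match x with
        | .r i => φ i
        | .sr i => g * φ i
      map_one' := h0
      map_mul' := by
        rintro (i | i) (j | j)
        · rw [DihedralGroup.r_mul_r]; exact hadd i j
        · rw [DihedralGroup.r_mul_sr]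
          change g * φ (j - i) = φ i * (g * φ j)
          rw [hsub, ← mul_assoc, ← mul_assoc, hneg]
        · rw [DihedralGroup.sr_mul_r]
          change g * φ (i + j) = g * φ i * φ j
          rw [hadd, mul_assoc]
        · rw [DihedralGroup.sr_mul_sr]
          change φ (j - i) = g * φ i * (g * φ j)
          rw [mul_assoc, ← mul_assoc (φ i), hneg, mul_assoc, ← mul_assoc, hg, one_mul, hsub] }
  have hinj : Function.Injective f := by
    rw [injective_iff_map_eq_one]
    rintro (i | i) hi
    · change φ i = 1 at hi
      obtain ⟨i, rfl⟩ := ZMod.intCast_surjective i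
      rw [hφ, ← orderOf_dvd_iff_zpow_eq_one, hb, ← ZMod.intCast_zmod_eq_zero_iff_dvd] at hi
      rw [hi, DihedralGroup.r_zero]
    · change g * φ i = 1 at hi
      exact absurd (by rw [eq_inv_of_mul_eq_one_left hi]; exact inv_mem (hmem i)) hgn
  have hrange : f.range = Subgroup.zpowers b ⊔ Subgroup.zpowers g := by
    apply le_antisymm
    · rintro _ ⟨i | i, rfl⟩
      · exact Subgroup.mem_sup_left (hmem i)
      · exact Subgroup.mul_mem _ (Subgroup.mem_sup_right (Subgroup.mem_zpowers g))
          (Subgroup.mem_sup_left (hmem i))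
    · rw [sup_le_iff, Subgroup.zpowers_le, Subgroup.zpowers_le]
      refine ⟨⟨.r 1, ?_⟩, ⟨.sr 0, ?_⟩⟩
      · change φ 1 = b
        simpa using hφ 1
      · change g * φ 0 = g
        rw [h0, mul_one]
  exact ⟨((MonoidHom.ofInjective hinj).trans (MulEquiv.subgroupCongr hrange)).symm⟩

/-! ### Normalizers and the rank-one structure in the image of `SL(2, p)`. -/

namespace SL2

variable {p : ℕ} [hp : Fact p.Prime] {G : Type*} [Group G]
  {ψ : Matrix.SpecialLinearGroup (Fin 2) (ZMod p) →* G}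

theorem eq_of_torus_eq {F : Type*} [Field F] {s t : Fˣ} (h : torus s = torus t) : s = t :=
  Units.ext (ext_entries.mp h).1

namespace IsProjection

theorem mem_zpowers_unip {x : ZMod p} (hx : x ≠ 0) {y : G} :
    y ∈ Subgroup.zpowers (ψ (unip x)) ↔ ∃ t, y = ψ (unip t) := by
  constructor
  · rintro ⟨k, rfl⟩
    exact ⟨k * x, by simp [← unip_zpow]⟩
  · rintro ⟨t, rfl⟩
    obtain ⟨k, hk⟩ := ZMod.intCast_surjective (t / x)
    exact ⟨k, by simp [← map_zpow, unip_zpow, hk, hx]⟩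

/-- As `p` is odd, a sign change gives a lift `M` with `M ^ p = 1`. In characteristic `p` this makes
`M - 1` nilpotent, so `M` fixes a nonzero vector; a basis of determinant one starting with it makes
`M` upper unipotent. -/
theorem exists_eq_unip (hψ : IsProjection ψ) (hp2 : p ≠ 2) {a : G} (ha : orderOf a = p) :
    ∃ ψ' : Matrix.SpecialLinearGroup (Fin 2) (ZMod p) →* G, IsProjection ψ' ∧
      ∃ x : ZMod p, x ≠ 0 ∧ a = ψ' (unip x) := by
  have hodd : Odd p := hp.out.odd_of_ne_two hp2
  obtain ⟨M, hM, hMp⟩ : ∃ M, ψ M = a ∧ M ^ p = 1 := by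
    obtain ⟨M, hM⟩ := hψ.surjective a
    have : ψ (M ^ p) = 1 := by rw [map_pow, hM, ← ha, pow_orderOf_eq_one]
    rcases (hψ.eq_one_iff _).mp this with h | h
    · exact ⟨M, hM, h⟩
    · exact ⟨-M, by rw [hψ.map_neg, hM], by rw [hodd.neg_pow, h, neg_neg]⟩
  have hdet : (M.1 - 1).det = 0 := by
    have h1 : (M.1 - 1) ^ p = 0 := by
      rw [sub_pow_char_of_commute p (Commute.one_right M.1), one_pow, sub_eq_zero]
      exact congrArg Subtype.val hMp
    refine pow_eq_zero_iff hp.out.ne_zero |>.mp ?_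
    rw [← Matrix.det_pow, h1]
    exact Matrix.det_zero
  obtain ⟨v, hv0, hv⟩ := Matrix.exists_mulVec_eq_zero_iff.mpr hdet
  obtain ⟨N, hN0, hN1⟩ : ∃ N : Matrix.SpecialLinearGroup (Fin 2) (ZMod p),
      N 0 0 = v 0 ∧ N 1 0 = v 1 := by
    by_cases h0 : v 0 = 0
    · have h1 : v 1 ≠ 0 := fun h1 => hv0 (by ext i; fin_cases i <;> assumption)
      exact ⟨⟨!![v 0, -(v 1)⁻¹; v 1, 0], by simp [Matrix.det_fin_two, h1]⟩, rfl, rfl⟩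
    · exact ⟨⟨!![v 0, 0; v 1, (v 0)⁻¹], by simp [Matrix.det_fin_two, h0]⟩, rfl, rfl⟩
  have e0 : M 0 0 * v 0 + M 0 1 * v 1 = v 0 := by
    have := congrFun hv 0
    simp [Matrix.mulVec, dotProduct, Fin.sum_univ_two] at this
    linear_combination this
  have e1 : M 1 0 * v 0 + M 1 1 * v 1 = v 1 := by
    have := congrFun hv 1
    simp [Matrix.mulVec, dotProduct, Fin.sum_univ_two] at this
    linear_combination this
  set U := N⁻¹ * M * N with hU
  have hNU : N * U = M * N := by rw [hU]; group
  obtain ⟨f0, -, f1, -⟩ := ext_entries.mp hNU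
  rw [mul_entry, mul_entry M N, hN0, hN1] at f0 f1
  rw [e0] at f0
  rw [e1] at f1
  have hdN := det_entries N
  rw [hN0, hN1] at hdN
  have u0 : U 0 0 = 1 := by
    linear_combination N 1 1 * f0 - N 0 1 * f1 + (1 - U 0 0) * hdN
  have u1 : U 1 0 = 0 := by
    linear_combination v 0 * f1 - v 1 * f0 - U 1 0 * hdN
  have hdU := det_entries U
  rw [u0, u1, one_mul, mul_zero, sub_zero] at hdU
  have hUx : U = unip (U 0 1) := by
    rw [ext_entries]; simp [u0, u1, hdU]
  have haU : a = ψ.comp (MulAut.conj N).toMonoidHom U := by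
    rw [comp_conj_apply, hNU]; simp [hM]
  refine ⟨_, hψ.comp_conj N, U 0 1, fun hx => ?_, hUx ▸ haU⟩
  rw [hUx, hx, unip_zero, map_one] at haU
  rw [haU, orderOf_one] at ha
  exact hp.out.one_lt.ne ha

theorem mem_normalizer_unip (hψ : IsProjection ψ) (h2 : (2 : ZMod p) ≠ 0) {x : ZMod p}
    (hx : x ≠ 0) {y : G} :
    y ∈ Subgroup.normalizer (Subgroup.zpowers (ψ (unip x)) : Set G) ↔
      ∃ s t, y = ψ (torus s * unip t) := by
  constructor
  · intro hy
    obtain ⟨M, rfl⟩ := hψ.surjective y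
    obtain ⟨t, ht⟩ := (mem_zpowers_unip hx).mp
      ((Subgroup.mem_normalizer_iff.mp hy _).mp (Subgroup.mem_zpowers _))
    -- The relation lifts up to sign: one sign gives `M 1 0 * x = 0`, the other `2 * M 1 0 = 0`.
    have hM : M 1 0 = 0 := by
      rw [← map_inv, ← map_mul, ← map_mul, hψ.eq_iff, mul_inv_eq_iff_eq_mul,
        mul_inv_eq_iff_eq_mul, ext_entries, ext_entries] at ht
      simp only [mul_entry, neg_entry, unip_00, unip_01, unip_10, unip_11] at ht
      rcases ht with ⟨-, -, -, ht⟩ | ⟨-, -, ht, -⟩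
      · have : M 1 0 * x = 0 := by linear_combination ht
        exact (mul_eq_zero.mp this).resolve_right hx
      · have : 2 * M 1 0 = 0 := by linear_combination ht
        exact (mul_eq_zero.mp this).resolve_left h2
    obtain ⟨s, t, rfl⟩ := eq_torus_mul_unip hM
    exact ⟨s, t, rfl⟩
  · rintro ⟨s, t, rfl⟩
    rw [map_mul]
    refine Subgroup.mul_mem _ ?_ (Subgroup.le_normalizer ((mem_zpowers_unip hx).mpr ⟨t, rfl⟩))
    have hconj : ∀ (s : (ZMod p)ˣ), ∀ z ∈ Subgroup.zpowers (ψ (unip x)),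
        ψ (torus s) * z * (ψ (torus s))⁻¹ ∈ Subgroup.zpowers (ψ (unip x)) := fun s z hz => by
      obtain ⟨r, rfl⟩ := (mem_zpowers_unip hx).mp hz
      rw [← map_inv, ← map_mul, ← map_mul, torus_conj_unip]
      exact (mem_zpowers_unip hx).mpr ⟨_, rfl⟩
    refine Subgroup.mem_normalizer_iff.mpr fun z => ⟨hconj s z, fun hz => ?_⟩
    have := hconj s⁻¹ _ hz
    rw [← torus_inv, map_inv] at this
    convert this using 1
    group

theorem unip_eq_torus (hψ : IsProjection ψ) {x : ZMod p} {s : (ZMod p)ˣ}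
    (h : ψ (unip x) = ψ (torus s)) : ψ (unip x) = 1 := by
  have hx : x = 0 := by
    rw [hψ.eq_iff, ext_entries, ext_entries] at h
    rw [neg_entry, neg_entry, unip_01, torus_01, neg_zero] at h
    exact h.elim (fun h => h.2.1) (fun h => h.2.1)
  rw [hx, unip_zero, map_one]

theorem torus_eq_torus_iff (hψ : IsProjection ψ) {s t : (ZMod p)ˣ} :
    ψ (torus s) = ψ (torus t) ↔ s = t ∨ s = -t := by
  rw [hψ.eq_iff, ← torus_neg]
  exact ⟨Or.imp eq_of_torus_eq eq_of_torus_eq, Or.imp (congrArg _) (congrArg _)⟩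

/-- The kernel halves the order of a generator: `s ^ k = ±1` exactly when `s ^ (2k) = 1`. -/
theorem orderOf_torus (hψ : IsProjection ψ) (hp2 : p ≠ 2) {s : (ZMod p)ˣ}
    (hs : ∀ v, v ∈ Subgroup.zpowers s) : orderOf (ψ (torus s)) = (p - 1) / 2 := by
  have hos : orderOf s = p - 1 := by
    rw [orderOf_eq_card_of_forall_mem_zpowers hs, Nat.card_eq_fintype_card, ZMod.card_units]
  obtain ⟨m, hm⟩ := hp.out.odd_of_ne_two hp2
  have key : ∀ k : ℕ, ψ (torus s) ^ k = 1 ↔ (p - 1) / 2 ∣ k := fun k => by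
    have e : ψ (torus s) ^ k = ψ (torus (s ^ k)) := by
      rw [← map_pow, ← zpow_natCast, torus_zpow, zpow_natCast]
    rw [e, ← map_one ψ, ← torus_one, hψ.torus_eq_torus_iff]
    have e2 : (s ^ k = 1 ∨ s ^ k = -1) ↔ s ^ (2 * k) = 1 := by
      rw [mul_comm 2, pow_mul, Units.ext_iff, Units.ext_iff, Units.ext_iff]
      push_cast
      exact sq_eq_one_iff.symm
    rw [e2, ← orderOf_dvd_iff_pow_eq_one, hos, hm]
    have : (2 * m + 1 - 1) = 2 * m := by omega
    rw [this, Nat.mul_div_cancel_left _ (by norm_num), Nat.mul_dvd_mul_iff_left (by norm_num)]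
  exact Nat.dvd_antisymm (orderOf_dvd_of_pow_eq_one ((key _).mpr dvd_rfl))
    ((key _).mp (pow_orderOf_eq_one _))

theorem mem_zpowers_torus {s : (ZMod p)ˣ} {y : G} (hy : y ∈ Subgroup.zpowers (ψ (torus s))) :
    ∃ k : ℤ, y = ψ (torus (s ^ k)) := by
  obtain ⟨k, rfl⟩ := hy
  exact ⟨k, by simp [← torus_zpow]⟩

theorem torus_mem_zpowers (hψ : IsProjection ψ) {s : (ZMod p)ˣ}
    (hs : ∀ v, ∃ k : ℤ, v = s ^ k ∨ v = -s ^ k) (v : (ZMod p)ˣ) :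
    ψ (torus v) ∈ Subgroup.zpowers (ψ (torus s)) := by
  obtain ⟨k, hk⟩ := hs v
  refine ⟨k, ?_⟩
  change ψ (torus s) ^ k = _
  rw [← map_zpow, torus_zpow, eq_comm, hψ.torus_eq_torus_iff]
  exact hk

theorem unip_inf_torus (hψ : IsProjection ψ) {x : ZMod p} (hx : x ≠ 0) (s : (ZMod p)ˣ) :
    Subgroup.zpowers (ψ (unip x)) ⊓ Subgroup.zpowers (ψ (torus s)) = ⊥ := by
  rw [eq_bot_iff]
  rintro y ⟨hy, hy'⟩
  obtain ⟨t, rfl⟩ := (mem_zpowers_unip hx).mp hy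
  obtain ⟨k, hk⟩ := mem_zpowers_torus hy'
  exact hψ.unip_eq_torus hk

theorem normalizer_unip (hψ : IsProjection ψ) (h2 : (2 : ZMod p) ≠ 0) {x : ZMod p} (hx : x ≠ 0)
    {s : (ZMod p)ˣ} (hs : ∀ v, ∃ k : ℤ, v = s ^ k ∨ v = -s ^ k) :
    Subgroup.zpowers (ψ (unip x)) ⊔ Subgroup.zpowers (ψ (torus s)) =
      Subgroup.normalizer (Subgroup.zpowers (ψ (unip x)) : Set G) := by
  apply le_antisymm
  · refine sup_le Subgroup.le_normalizer (Subgroup.zpowers_le.mpr ?_)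
    exact (hψ.mem_normalizer_unip h2 hx).mpr ⟨s, 0, by rw [unip_zero, mul_one]⟩
  · intro y hy
    obtain ⟨v, t, rfl⟩ := (hψ.mem_normalizer_unip h2 hx).mp hy
    rw [map_mul]
    exact Subgroup.mul_mem _ (Subgroup.mem_sup_right (hψ.torus_mem_zpowers hs v))
      (Subgroup.mem_sup_left ((mem_zpowers_unip hx).mpr ⟨t, rfl⟩))

/-- Since `s ^ 4 ≠ 1`, the matrix `torus (s ^ 2)` has distinct eigenvalues, so a normalizing matrix
either fixes both coordinate axes or swaps them. -/
theorem mem_normalizer_torus (hψ : IsProjection ψ) {s : (ZMod p)ˣ} (hs4 : s ^ 4 ≠ 1) {y : G}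
    (hy : y ∈ Subgroup.normalizer (Subgroup.zpowers (ψ (torus s) ^ 2) : Set G)) :
    ∃ v, y = ψ (torus v) ∨ y = ψ (anti v) := by
  obtain ⟨M, rfl⟩ := hψ.surjective y
  have hsq : ψ (torus s) ^ 2 = ψ (torus (s ^ 2)) := by
    rw [sq, ← map_mul, torus_mul, sq]
  rw [hsq] at hy
  obtain ⟨k, hk⟩ := mem_zpowers_torus
    ((Subgroup.mem_normalizer_iff.mp hy _).mp (Subgroup.mem_zpowers _))
  obtain ⟨w, hw⟩ : ∃ w, M * torus (s ^ 2) = torus w * M := by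
    rw [← map_inv, ← map_mul, ← map_mul, hψ.eq_iff, ← torus_neg] at hk
    rcases hk with h | h <;> exact ⟨_, mul_inv_eq_iff_eq_mul.mp h⟩
  generalize hμ : s ^ 2 = μ at hw
  have hμ2 : (μ : ZMod p) ^ 2 ≠ 1 := fun e => hs4 (by
    ext
    rw [← hμ] at e
    push_cast at e ⊢
    linear_combination e)
  have hμ0 : (μ : ZMod p) ≠ 0 := μ.ne_zero
  have hw0 : (w : ZMod p) ≠ 0 := w.ne_zero
  rw [ext_entries] at hw
  simp only [mul_entry, torus_00, torus_01, torus_10, torus_11, mul_zero, zero_mul, add_zero,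
    zero_add] at hw
  obtain ⟨h00, h01, h10, h11⟩ := hw
  by_cases hM : M 0 0 = 0
  · have h01' : M 0 1 ≠ 0 := fun e => by
      have := det_entries M
      simp [hM, e] at this
    have hwμ : (w : ZMod p) = (μ : ZMod p)⁻¹ := by
      rw [mul_comm] at h01
      exact (mul_right_cancel₀ h01' h01).symm
    have : M 1 1 = 0 := by
      rw [hwμ, inv_inv] at h11
      field_simp at h11
      by_contra hne
      apply hμ2
      apply mul_left_cancel₀ hne
      linear_combination -h11
    obtain ⟨v, rfl⟩ := eq_anti hM this
    exact ⟨v, Or.inr rfl⟩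
  · have hwμ : (w : ZMod p) = μ := by
      rw [mul_comm] at h00
      exact (mul_right_cancel₀ hM h00).symm
    rw [hwμ] at h01 h10
    have h1 : M 0 1 = 0 := by
      field_simp at h01
      by_contra hne
      apply hμ2
      apply mul_left_cancel₀ hne
      linear_combination -h01
    have h2 : M 1 0 = 0 := by
      field_simp at h10
      by_contra hne
      apply hμ2
      apply mul_left_cancel₀ hne
      linear_combination h10
    obtain ⟨v, rfl⟩ := eq_torus h2 h1
    exact ⟨v, Or.inl rfl⟩

theorem anti_mul_self (hψ : IsProjection ψ) (c : (ZMod p)ˣ) : ψ (anti c) * ψ (anti c) = 1 := by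
  rw [← map_mul, anti_mul_anti, hψ.map_neg, map_one]

theorem anti_inverts (hψ : IsProjection ψ) (c s : (ZMod p)ˣ) :
    ψ (anti c) * ψ (torus s) * ψ (anti c) = (ψ (torus s))⁻¹ := by
  rw [← map_mul, ← map_mul, anti_mul_torus_mul_anti, hψ.map_neg, ← torus_inv, map_inv]

/-- Two of the three share a quadratic character. -/
theorem exists_sq_ratio {x y z : ZMod p} (hx : x ≠ 0) (hy : y ≠ 0) (hz : z ≠ 0) :
    (∃ v : (ZMod p)ˣ, y = v ^ 2 * x) ∨ (∃ v : (ZMod p)ˣ, z = v ^ 2 * x) ∨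
      ∃ v : (ZMod p)ˣ, z = v ^ 2 * y := by
  have key : ∀ u w : ZMod p, u ≠ 0 → w ≠ 0 → quadraticChar (ZMod p) u = quadraticChar (ZMod p) w →
      ∃ v : (ZMod p)ˣ, w = v ^ 2 * u := fun u w hu hw e => by
    have h1 : quadraticChar (ZMod p) (w / u) = 1 := by
      rw [div_eq_mul_inv, map_mul, ← e, ← map_mul, mul_inv_cancel₀ hu, map_one]
    obtain ⟨r, hr⟩ := (quadraticChar_one_iff_isSquare (div_ne_zero hw hu)).mp h1
    have hr0 : r ≠ 0 := fun e => div_ne_zero hw hu (by rw [hr, e, mul_zero])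
    refine ⟨Units.mk0 r hr0, ?_⟩
    rw [Units.val_mk0, sq, ← hr, div_mul_cancel₀ _ hu]
  rcases quadraticChar_dichotomy hx with ex | ex <;>
  rcases quadraticChar_dichotomy hy with ey | ey <;>
  rcases quadraticChar_dichotomy hz with ez | ez <;>
  first
  | exact Or.inl (key x y hx hy (ex.trans ey.symm))
  | exact Or.inr (Or.inl (key x z hx hz (ex.trans ez.symm)))
  | exact Or.inr (Or.inr (key y z hy hz (ey.trans ez.symm)))

theorem isRankOneTriple (hψ : IsProjection ψ) (h2 : (2 : ZMod p) ≠ 0) {x : ZMod p} (hx : x ≠ 0)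
    {s : (ZMod p)ˣ} (hs : ∀ v, ∃ k : ℤ, v = s ^ k ∨ v = -s ^ k) (c : (ZMod p)ˣ)
    (hax : (orderOf (ψ (unip x))).Prime) (heven : Even (orderOf (ψ (torus s)))) :
    IsRankOneTriple (ψ (unip x)) (ψ (torus s)) (ψ (anti c)) where
  prime_orderOf := hax
  mul_self := hψ.anti_mul_self c
  inverts := hψ.anti_inverts c s
  normalizes := (hψ.mem_normalizer_unip h2 hx).mpr ⟨s, 0, by rw [unip_zero, mul_one]⟩
  disjoint := hψ.unip_inf_torus hx s
  even := heven
  bruhat y := by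
    rw [hψ.normalizer_unip h2 hx hs]
    obtain ⟨M, rfl⟩ := hψ.surjective y
    by_cases hM : M 1 0 = 0
    · obtain ⟨v, t, rfl⟩ := eq_torus_mul_unip hM
      exact Or.inl ((hψ.mem_normalizer_unip h2 hx).mpr ⟨v, t, rfl⟩)
    · obtain ⟨v, t, r, e⟩ := eq_torus_unip_anti_unip c hM
      refine Or.inr ⟨_, (hψ.mem_normalizer_unip h2 hx).mpr ⟨v, t, rfl⟩, _,
        (mem_zpowers_unip hx).mpr ⟨r, rfl⟩, ?_⟩
      rw [← map_mul, ← map_mul, ← e]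
  generate K hA hK := by
    rw [eq_top_iff]
    intro y _
    obtain ⟨M, rfl⟩ := hψ.surjective y
    refine mem_of_unip_lower (K := K.comap ψ) (fun t => hA ((mem_zpowers_unip hx).mpr ⟨t, rfl⟩))
      (fun t => ?_) M
    -- The parameter is chosen so that conjugation by `anti c` yields `lower t`.
    have := hK _ ((mem_zpowers_unip hx).mpr ⟨-t * (c : ZMod p) ^ 2, rfl⟩)
    rw [← map_mul, ← map_mul, anti_mul_unip_mul_anti, hψ.map_neg] at this
    rw [Subgroup.mem_comap]
    convert this using 3
    field_simp
  orbits := by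
    have key : ∀ (t r : ZMod p) (v : (ZMod p)ˣ), r = v ^ 2 * t → ∃ k : ℤ,
        ψ (unip r) = ψ (torus s) ^ k * ψ (unip t) * ψ (torus s) ^ (-k) := fun t r v e => by
      obtain ⟨k, hk⟩ := hψ.torus_mem_zpowers hs v
      refine ⟨k, ?_⟩
      rw [zpow_neg]
      change ψ (torus s) ^ k = _ at hk
      rw [hk, ← map_inv, ← map_mul, ← map_mul, torus_conj_unip, ← e]
    have hne : ∀ t : ZMod p, ψ (unip t) ≠ 1 → t ≠ 0 := fun t ht e =>
      ht (by rw [e, unip_zero, map_one])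
    intro y hy z hz w hw hy1 hz1 hw1
    obtain ⟨y, rfl⟩ := (mem_zpowers_unip hx).mp hy
    obtain ⟨z, rfl⟩ := (mem_zpowers_unip hx).mp hz
    obtain ⟨w, rfl⟩ := (mem_zpowers_unip hx).mp hw
    exact (exists_sq_ratio (hne y hy1) (hne z hz1) (hne w hw1)).imp
      (fun ⟨v, e⟩ => key _ _ v e) (Or.imp (fun ⟨v, e⟩ => key _ _ v e) fun ⟨v, e⟩ => key _ _ v e)
  faithful y hy hcomm := by
    obtain ⟨k, rfl⟩ := mem_zpowers_torus hy
    generalize s ^ k = v at *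
    have hcomm' := hcomm.eq
    rw [← map_mul, ← map_mul, hψ.eq_iff, ext_entries, ext_entries] at hcomm'
    have hv0 : (v : ZMod p) ≠ 0 := v.ne_zero
    simp only [mul_entry, neg_entry, torus_00, torus_01, torus_10, torus_11, unip_00, unip_01,
      unip_10, unip_11, mul_zero, zero_mul, add_zero, zero_add, mul_one, one_mul] at hcomm'
    have hv : (v : ZMod p) ^ 2 = 1 := by
      rcases hcomm' with ⟨-, h, -⟩ | ⟨h, -⟩
      · field_simp at h
        exact h
      · have : 2 * (v : ZMod p) = 0 := by linear_combination h
        exact absurd ((mul_eq_zero.mp this).resolve_left h2) hv0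
    rw [← map_one ψ, ← torus_one, hψ.torus_eq_torus_iff, Units.ext_iff, Units.ext_iff]
    push_cast
    exact sq_eq_one_iff.mp hv

end IsProjection

end SL2

/-! ### The choices of `a`, `b` and `g` in `PSL(2, p)`. -/

namespace SL2

variable {p : ℕ} [hp : Fact p.Prime]

theorem two_ne_zero_zmod (hp2 : p ≠ 2) : (2 : ZMod p) ≠ 0 := fun h => by
  have : p ∣ 2 := (ZMod.natCast_eq_zero_iff 2 p).mp (by exact_mod_cast h)
  exact hp2 ((Nat.prime_dvd_prime_iff_eq hp.out Nat.prime_two).mp this)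

theorem exists_orderOf_eq (p : ℕ) [hp : Fact p.Prime] : ∃ a : PSL2 p, orderOf a = p := by
  refine ⟨QuotientGroup.mk' _ (unip 1), orderOf_eq_prime ?_ fun h => ?_⟩
  · have : (unip (1 : ZMod p)) ^ p = 1 := by
      rw [← zpow_natCast, unip_zpow]; simp [unip_zero]
    rw [← map_pow, this, map_one]
  · rw [isProjection_mk.eq_one_iff, ext_entries, ext_entries] at h
    rcases h with ⟨-, h, -⟩ | ⟨-, h, -⟩ <;> simp [neg_entry] at h

variable {ψ : Matrix.SpecialLinearGroup (Fin 2) (ZMod p) →* PSL2 p}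

theorem exists_isTorusChoice (hp2 : p ≠ 2) {a : PSL2 p} (ha : orderOf a = p) :
    ∃ b : PSL2 p, IsTorusChoice p a b := by
  obtain ⟨ψ, hψ, x, hx, rfl⟩ := isProjection_mk.exists_eq_unip hp2 ha
  obtain ⟨s, hs⟩ := IsCyclic.exists_generator (α := (ZMod p)ˣ)
  have hs' : ∀ v, ∃ k : ℤ, v = s ^ k ∨ v = -s ^ k := fun v => by
    obtain ⟨k, hk⟩ := hs v
    exact ⟨k, Or.inl hk.symm⟩
  exact ⟨ψ (torus s), hψ.orderOf_torus hp2 hs,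
    ⟨hψ.normalizer_unip (two_ne_zero_zmod hp2) hx hs', hψ.unip_inf_torus hx s, le_rfl⟩⟩

/-- Every pair `a`, `b` of the construction is in standard position for a suitable projection. -/
theorem exists_eq_torus (hp5 : 5 < p) {a b : PSL2 p} (ha : orderOf a = p)
    (hab : IsTorusChoice p a b) :
    ∃ ψ : Matrix.SpecialLinearGroup (Fin 2) (ZMod p) →* PSL2 p, IsProjection ψ ∧
      ∃ (x : ZMod p) (s : (ZMod p)ˣ), x ≠ 0 ∧ a = ψ (unip x) ∧ b = ψ (torus s) ∧
        ∀ v, ∃ k : ℤ, v = s ^ k ∨ v = -s ^ k := by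
  have h2 : (2 : ZMod p) ≠ 0 := two_ne_zero_zmod (by omega)
  obtain ⟨ψ, hψ, x, hx, rfl⟩ := isProjection_mk.exists_eq_unip (by omega) ha
  have hb : b ∈ Subgroup.normalizer (Subgroup.zpowers (ψ (unip x)) : Set (PSL2 p)) := by
    rw [← hab.normalizer_a.sup_eq]
    exact Subgroup.mem_sup_right (Subgroup.mem_zpowers b)
  obtain ⟨s, t, hst⟩ := (hψ.mem_normalizer_unip h2 hx).mp hb
  -- If `s = ±1`, then `b` lies in `⟨a⟩ ∩ ⟨b⟩ = 1`, against its order.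
  have hs : (s : ZMod p)⁻¹ ^ 2 - 1 ≠ 0 := fun hs => by
    have hs1 : ψ (torus s) = 1 := by
      rw [← map_one ψ, ← torus_one, hψ.torus_eq_torus_iff, Units.ext_iff, Units.ext_iff]
      push_cast
      rw [sub_eq_zero, inv_pow, inv_eq_one] at hs
      exact sq_eq_one_iff.mp hs
    rw [map_mul, hs1, one_mul] at hst
    have : b ∈ Subgroup.zpowers (ψ (unip x)) ⊓ Subgroup.zpowers b :=
      ⟨(IsProjection.mem_zpowers_unip hx).mpr ⟨t, hst⟩, Subgroup.mem_zpowers b⟩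
    rw [hab.normalizer_a.inf_eq, Subgroup.mem_bot] at this
    have ho := hab.order_b
    rw [this, orderOf_one] at ho
    omega
  -- By `unip_conj_torus`, this `r` makes conjugation by `unip r` carry `torus s` to `torus s * unip
  -- t`; it commutes with `unip x`.
  set r := t / ((s : ZMod p)⁻¹ ^ 2 - 1) with hr
  have hψ' := hψ.comp_conj (unip r)
  have ha' : ψ (unip x) = ψ.comp (MulAut.conj (unip r)).toMonoidHom (unip x) := by
    rw [IsProjection.comp_conj_apply, unip_inv, unip_mul, unip_mul]
    congr 2; ring
  have hb' : b = ψ.comp (MulAut.conj (unip r)).toMonoidHom (torus s) := by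
    rw [IsProjection.comp_conj_apply, unip_conj_torus, hr, div_mul_cancel₀ _ hs, hst]
  refine ⟨_, hψ', x, s, hx, ha', hb', fun v => ?_⟩
  generalize ψ.comp (MulAut.conj (unip r)).toMonoidHom = ψ' at *
  rw [ha', hb'] at hab
  -- Every torus element normalizes `⟨a⟩`, hence lies in `⟨a⟩⟨b⟩`, and its unipotent part there must
  -- be trivial.
  have hv := (hψ'.mem_normalizer_unip h2 hx).mpr ⟨v, 0, rfl⟩
  rw [← hab.normalizer_a.sup_eq, mem_sup_zpowers_of_mem_normalizer
    (by rwa [← ha', ← hb']), unip_zero, mul_one] at hv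
  obtain ⟨z, hz, k, e⟩ := hv
  obtain ⟨y, rfl⟩ := (IsProjection.mem_zpowers_unip hx).mp hz
  rw [← map_zpow, torus_zpow] at e
  have e' : ψ' (unip y) = ψ' (torus (v * (s ^ k)⁻¹)) := by
    rw [← torus_mul, ← torus_inv, map_mul, e, map_inv]; group
  rw [hψ'.unip_eq_torus e', one_mul, hψ'.torus_eq_torus_iff] at e
  exact ⟨k, e⟩

/-- Otherwise `(p - 1) / 2` divides 4, leaving only `p = 9`, which is not prime. -/
theorem pow_four_ne_one (hp5 : 5 < p) (hmod : p % 4 = 1) {s : (ZMod p)ˣ}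
    (hs : orderOf (ψ (torus s)) = (p - 1) / 2) : s ^ 4 ≠ 1 := fun h => by
  have : ψ (torus s) ^ 4 = 1 := by
    rw [← map_pow, ← zpow_natCast, torus_zpow, zpow_natCast, h, torus_one, map_one]
  have hd := orderOf_dvd_of_pow_eq_one this
  rw [hs] at hd
  have hle := Nat.le_of_dvd (by norm_num) hd
  have hp9 : p ≠ 9 := by rintro rfl; exact absurd hp.out (by norm_num)
  omega

theorem torus_ne_anti (hψ : IsProjection ψ) (v c : (ZMod p)ˣ) :
    ψ (torus v) ≠ ψ (anti c) := fun h => by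
  rw [hψ.eq_iff, ext_entries, ext_entries] at h
  rw [neg_entry, torus_00, anti_00, neg_zero] at h
  exact v.ne_zero (h.elim (fun h => h.1) (fun h => h.1))

theorem exists_isInvolutionChoice (hp5 : 5 < p) (hmod : p % 4 = 1) {a b : PSL2 p}
    (ha : orderOf a = p) (hab : IsTorusChoice p a b) : ∃ g : PSL2 p, IsInvolutionChoice p b g := by
  obtain ⟨ψ, hψ, x, s, hx, rfl, rfl, hs⟩ := exists_eq_torus hp5 ha hab
  have hs4 := pow_four_ne_one hp5 hmod hab.order_b
  have hgn : ψ (anti 1) ∉ Subgroup.zpowers (ψ (torus s)) := fun h => by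
    obtain ⟨k, hk⟩ := IsProjection.mem_zpowers_torus h
    exact torus_ne_anti hψ _ _ hk.symm
  have hg1 : ψ (anti 1) ≠ 1 := fun h => hgn (h ▸ one_mem _)
  have hinv : (ψ (anti 1))⁻¹ = ψ (anti 1) := inv_eq_of_mul_eq_one_left (hψ.anti_mul_self 1)
  have hnorm : ∀ w : (ZMod p)ˣ, ψ (anti 1) ∈
      Subgroup.normalizer (Subgroup.zpowers (ψ (torus w)) : Set (PSL2 p)) := fun w => by
    have key : ∀ z ∈ Subgroup.zpowers (ψ (torus w)),
        ψ (anti 1) * z * (ψ (anti 1))⁻¹ ∈ Subgroup.zpowers (ψ (torus w)) := fun z hz => by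
      obtain ⟨k, rfl⟩ := hz
      refine ⟨-k, ?_⟩
      change _ = ψ (anti 1) * ψ (torus w) ^ k * (ψ (anti 1))⁻¹
      rw [← conj_zpow, hinv, hψ.anti_inverts, inv_zpow]
      exact zpow_neg _ _
    refine Subgroup.mem_normalizer_iff.mpr fun z => ⟨key z, fun hz => ?_⟩
    have := key _ hz
    rw [hinv] at this
    convert this using 1
    have e := hψ.anti_mul_self 1
    calc z = ψ (anti 1) * ψ (anti 1) * z * (ψ (anti 1) * ψ (anti 1)) := by rw [e]; group
      _ = _ := by group
  have hsup : Subgroup.zpowers (ψ (torus s)) ⊔ Subgroup.zpowers (ψ (anti 1)) =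
      Subgroup.normalizer (Subgroup.zpowers (ψ (torus s) ^ 2) : Set (PSL2 p)) := by
    apply le_antisymm
    · rw [sup_le_iff, Subgroup.zpowers_le, Subgroup.zpowers_le]
      constructor
      · refine Subgroup.centralizer_le_normalizer _ ?_
        rw [Subgroup.mem_centralizer_iff]
        rintro _ ⟨k, rfl⟩
        exact (((Commute.refl (ψ (torus s))).pow_left 2).zpow_left k).eq
      · have := hnorm (s ^ 2)
        rwa [sq, ← torus_mul, map_mul, ← sq] at this
    · intro y hy
      obtain ⟨v, rfl | rfl⟩ := hψ.mem_normalizer_torus hs4 hy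
      · exact Subgroup.mem_sup_left (hψ.torus_mem_zpowers hs v)
      · rw [← torus_mul_anti_one v, map_mul]
        exact Subgroup.mul_mem _ (Subgroup.mem_sup_left (hψ.torus_mem_zpowers hs v))
          (Subgroup.mem_sup_right (Subgroup.mem_zpowers _))
  refine ⟨ψ (anti 1), orderOf_eq_prime (by rw [sq, hψ.anti_mul_self]) hg1,
    ⟨hsup, ?_, ?_⟩, ?_⟩
  · rw [eq_bot_iff]
    rintro y ⟨hy, k, rfl⟩
    obtain ⟨m, rfl | rfl⟩ := Int.even_or_odd' k
    · change ψ (anti 1) ^ (2 * m) = 1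
      rw [zpow_mul, zpow_two, hψ.anti_mul_self, one_zpow]
    · change ψ (anti 1) ^ (2 * m + 1) ∈ _ at hy
      rw [zpow_add_one, zpow_mul, zpow_two, hψ.anti_mul_self, one_zpow, one_mul] at hy
      exact absurd hy hgn
  · rw [← hsup, sup_le_iff, Subgroup.zpowers_le (H := Subgroup.normalizer _)]
    rw [Subgroup.zpowers_le]
    exact ⟨Subgroup.le_normalizer (Subgroup.mem_zpowers _), hnorm s⟩
  · rw [← hsup]
    exact nonempty_mulEquiv_dihedralGroup hab.order_b (hψ.anti_mul_self 1)
      (hψ.anti_inverts 1 s) hgn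

/-- By `mem_normalizer_torus`, `g` is diagonal or antidiagonal. All diagonal elements lie in `⟨b⟩`,
which meets `⟨g⟩` trivially, so `g` is antidiagonal. -/
theorem isRankOneTriple_of_choice (hp5 : 5 < p) (hmod : p % 4 = 1) {a b g : PSL2 p}
    (ha : orderOf a = p) (hab : IsTorusChoice p a b) (hbg : IsInvolutionChoice p b g) :
    IsRankOneTriple a b g := by
  obtain ⟨ψ, hψ, x, s, hx, rfl, rfl, hs⟩ := exists_eq_torus hp5 ha hab
  have hs4 := pow_four_ne_one hp5 hmod hab.order_b
  have hg : g ∈ Subgroup.normalizer (Subgroup.zpowers (ψ (torus s) ^ 2) : Set (PSL2 p)) := by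
    rw [← hbg.normalizer_b.sup_eq]
    exact Subgroup.mem_sup_right (Subgroup.mem_zpowers g)
  obtain ⟨c, rfl | rfl⟩ := hψ.mem_normalizer_torus hs4 hg
  · have : ψ (torus c) ∈ Subgroup.zpowers (ψ (torus s)) ⊓ Subgroup.zpowers (ψ (torus c)) :=
      ⟨hψ.torus_mem_zpowers hs c, Subgroup.mem_zpowers _⟩
    rw [hbg.normalizer_b.inf_eq, Subgroup.mem_bot] at this
    have ho := hbg.order_g
    rw [this, orderOf_one] at ho
    omega
  · refine hψ.isRankOneTriple (two_ne_zero_zmod (by omega)) hx hs c (by rw [ha]; exact hp.out) ?_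
    rw [hab.order_b]
    exact ⟨(p - 1) / 4, by omega⟩

end SL2

theorem mainTheorem7 (p : ℕ) (hp : p.Prime) (hp5 : 5 < p) (hmod : p % 4 = 1) :
    -- the choices of the construction can be made
    (∃ a : PSL2 p, orderOf a = p) ∧
    (∀ a : PSL2 p, orderOf a = p → ∃ b : PSL2 p, IsTorusChoice p a b) ∧
    (∀ a b : PSL2 p, orderOf a = p → IsTorusChoice p a b →
      ∃ g : PSL2 p, IsInvolutionChoice p b g) ∧
    -- and every choice gives a graph with the required properties
    (∀ a b g : PSL2 p, orderOf a = p → IsTorusChoice p a b → IsInvolutionChoice p b g →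
      IsInternalSemidirect (subgroupH a b) (Subgroup.zpowers a) (Subgroup.zpowers (b ^ 2)) ∧
      orderOf (b ^ 2) = (p - 1) / 4 ∧
      ∃ h : IsCosetDatum (subgroupH a b) g,
        (cosetGraph (subgroupH a b) g h).Connected ∧
        (∀ v, ((cosetGraph (subgroupH a b) g h).neighborSet v).ncard = p) ∧
        IsGeodesicTransitive (cosetGraph (subgroupH a b) g h) 2 ∧
        ¬ IsArcTransitive (cosetGraph (subgroupH a b) g h) 2) := by
  have : Fact p.Prime := ⟨hp⟩
  refine ⟨SL2.exists_orderOf_eq p, fun a ha => SL2.exists_isTorusChoice (by omega) ha,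
    fun a b ha hab => SL2.exists_isInvolutionChoice hp5 hmod ha hab, fun a b g ha hab hbg => ?_⟩
  have h := SL2.isRankOneTriple_of_choice hp5 hmod ha hab hbg
  refine ⟨h.semidirect, ?_, h.isCosetDatum, cosetGraph_connected _ _ _,
    fun v => (h.ncard_neighborSet h.isCosetDatum v).trans ha, h.isGeodesicTransitive _,
    h.not_isArcTransitive _⟩
  rw [orderOf_pow_of_dvd (by norm_num), hab.order_b]
  · omega
  · rw [hab.order_b]
    omega
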